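/- Let $n\ge 3$, $N=\lfloor (n+1)/2\rfloor$, and let $A=\mathbb C^{n+1}$ with standard basis $e_1,\dots,e_{n+1}$ be the simple $n$-Lie algebra, whose bracket is the alternating $n$-linear map with $[e_1,\dots,\widehat{e_i},\dots,e_{n+1}]=(-1)^{n+i+1}e_i$. An $n$-Lie module of $A$ is a vector space $M$ with an $n$-Lie algebra structure on $A\oplus M$ (an alternating $n$-ary bracket satisfying $[[x_1,\dots,x_n],y_1,\dots,y_{n-1}]=\sum_{i}[x_1,\dots,[x_i,y_1,\dots,y_{n-1}],\dots,x_n]$) such that $A$ is a subalgebra and $M$ is an abelian ideal (brackets with at least two entries in $M$ vanish). It is irreducible if $M\neq 0$ and $M$ has no subspaces other than $0$ and $M$ stable under all maps $m\mapsto[a_1,\dots,a_{n-1},m]$, $a_i\in A$. Identify the basic Lie algebra $\wedge^{n-1}A$ of $A$ with the Lie algebra $so(n+1)$ of skew-symmetric complex matrices through $a_1\wedge\dots\wedge a_{n-1}\mapsto\big(b\mapsto[a_1,\dots,a_{n-1},b]\big)$, let $U=U(so(n+1))$, and let $Q(A)$ be the two-sided ideal of $U$ generated by the elements $$[a_1,\dots,a_n]\wedge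 a_{n+1}\wedge\dots\wedge a_{2n-2}-\sum_{i=1}^n(-1)^{i+n}(a_1\wedge\dots\wedge\widehat{a_i}\wedge\dots\wedge a_n)(a_i\wedge a_{n+1}\wedge\dots\wedge a_{2n-2}),\qquad a_1,\dots,a_{2n-2}\in A.$$ For $u,w\in A$ write $u\wedge w=uw^{T}-wu^{T}\in so(n+1)$. Put $v_{\pm j}=(e_{2j-1}\mp i e_{2j})/\sqrt2$ for $1\le j\le N$, and $v_0=e_{n+1}$ if $n+1$ is odd. Let $H=\bigoplus_{j=1}^N\mathbb C\epsilon_j$ with $\epsilon_j=i(e_{2j-1}\wedge e_{2j})$; this is a Cartan subalgebra. The positive root vectors are $v_j\wedge v_{\pm k}$ for $j<k$, and, if $n+1$ is odd, also $v_0\wedge v_j$. For $\lambda\in H^*$ put $\lambda_j=\lambda(\epsilon_j)$, let $I(\lambda)$ be the left ideal of $U$ generated by the positive root vectors and by all $h-\lambda(h)1$, $h\in H$, let $J(\lambda)$ be the unique maximal left ideal containing $I(\lambda)$, and let $Z(\lambda)=U/J(\lambda)$ be the irreducible highest weight module of highest weight $\lambda$. Let $\pi_1,\dots,\pi_N\in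 H^*$ be the fundamental weights of $so(n+1)$, and put $\pi_0=0$. Then for every $\lambda\in H^*$ the following are equivalent: 1. $Z(\lambda)$ is an irreducible module of the $n$-Lie algebra $A$, i.e. it carries an irreducible $n$-Lie module structure with $[a_1,\dots,a_{n-1},m]=(a_1\wedge\dots\wedge a_{n-1})\cdot m$ for all $a_i\in A$ and $m\in Z(\lambda)$; 2. $Z(\lambda)$ is a simple $U$-module and $Q(A)$ acts trivially on it; 3. there are $t\in\{1,\dots,N\}$ and $x\in\mathbb C$ with $\lambda_1=\dots=\lambda_{t-1}=-1$, $\lambda_t=x$ and $\lambda_{t+1}=\dots=\lambda_N=0$; 4. $\lambda_k(\lambda_j+1)=0$ for all $1\le j<k\le N$; 5. there are $t\in\{1,\dots,N\}$ and $x\in\mathbb C$ such that, if $n+1=2N$, $$\lambda=\begin{cases}(-1-x)\pi_{t-1}+x\pi_t & t<N-1,\\ (-1-x)\pi_{N-2}+x\pi_{N-1}+x\pi_N & t=N-1,\\ (-1-x)\pi_{N-1}+(-1+x)\pi_N & t=N,\end{cases}$$ and, if $n+1=2N+1$, $$\lambda=\begin{cases}(-1-x)\pi_{t-1}+x\pi_t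 & t<N,\\ (-1-x)\pi_{N-1}+2x\,\pi_N & t=N.\end{cases}$$ -/

import Mathlib

/-!
Throughout `n = d + 2`, so that `A = ℂ^(n+1)` is `Fin (d + 3) → ℂ`, the `n`-ary bracket takes
arguments indexed by `Fin (d + 2)`, and elements of `∧^(n-1) A` are written with arguments indexed
by `Fin (d + 1)`. Indices of coordinates start at `0`.
-/

namespace NLie

open LieAlgebra.Orthogonal

attribute [local instance] LieRing.ofAssociativeRing

/-! ### `n`-Lie algebras and their modules -/

/-- The generalized Jacobi identity for an alternating `n`-linear bracket, `n = d + 2`: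
`[[x₁,…,xₙ],y₁,…,yₙ₋₁] = ∑ᵢ [x₁,…,[xᵢ,y₁,…,yₙ₋₁],…,xₙ]`. -/
def IsNLieBracket {d : ℕ} {V : Type*} [AddCommGroup V] [Module ℂ V]
    (br : V [⋀^Fin (d + 2)]→ₗ[ℂ] V) : Prop :=
  ∀ (x : Fin (d + 2) → V) (y : Fin (d + 1) → V),
    br (Fin.cons (br x) y) = ∑ i, br (Function.update x i (br (Fin.cons (x i) y)))

/-- `br` is an `n`-Lie algebra structure on `V ⊕ M` for which `V` (with bracket `brV`) is a
subalgebra and `M` is an abelian ideal: this is what it means for `M` to be an `n`-Lie module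
of `V`. -/
structure IsNLieModule {d : ℕ} {V M : Type*} [AddCommGroup V] [Module ℂ V]
    [AddCommGroup M] [Module ℂ M] (brV : V [⋀^Fin (d + 2)]→ₗ[ℂ] V)
    (br : (V × M) [⋀^Fin (d + 2)]→ₗ[ℂ] (V × M)) : Prop where
  isNLieBracket : IsNLieBracket br
  subalgebra : ∀ x : Fin (d + 2) → V, br (fun k => (x k, 0)) = (brV x, 0)
  ideal : ∀ (z : Fin (d + 2) → V × M) (k : Fin (d + 2)), (z k).1 = 0 → (br z).1 = 0
  abelian : ∀ (z : Fin (d + 2) → V × M) (j k : Fin (d + 2)), j ≠ k →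
    (z j).1 = 0 → (z k).1 = 0 → br z = 0

/-- The action `[a₁,…,aₙ₋₁,m]` of `a₁ ∧ … ∧ aₙ₋₁` on an element `m` of an `n`-Lie module. -/
def nAction {d : ℕ} {V M : Type*} [AddCommGroup V] [Module ℂ V]
    [AddCommGroup M] [Module ℂ M] (br : (V × M) [⋀^Fin (d + 2)]→ₗ[ℂ] (V × M))
    (a : Fin (d + 1) → V) (m : M) : V × M :=
  br (Fin.snoc (α := fun _ => V × M) (fun k => (a k, (0 : M))) ((0 : V), m))

/-- An `n`-Lie module `M` is irreducible if it is nonzero and has no submodules besides `0`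
and `M`. -/
def IsIrreducibleNLieModule {d : ℕ} {V M : Type*} [AddCommGroup V] [Module ℂ V]
    [AddCommGroup M] [Module ℂ M] (brV : V [⋀^Fin (d + 2)]→ₗ[ℂ] V)
    (br : (V × M) [⋀^Fin (d + 2)]→ₗ[ℂ] (V × M)) : Prop :=
  IsNLieModule brV br ∧ Nontrivial M ∧
    ∀ W : Submodule ℂ M,
      (∀ (a : Fin (d + 1) → V), ∀ m ∈ W, (nAction br a m).2 ∈ W) → W = ⊥ ∨ W = ⊤

/-! ### The simple `n`-Lie algebra `A` and its basic Lie algebra `so(n+1)` -/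

/-- The underlying space `ℂ^(n+1)` of the simple `n`-Lie algebra, `n = d + 2`. -/
abbrev A (d : ℕ) : Type := Fin (d + 3) → ℂ

/-- The standard basis vectors of `A`. -/
def e {d : ℕ} (i : Fin (d + 3)) : A d := Pi.single i 1

/-- The generalized vector product on `A = ℂ^(n+1)`: the `i`-th coordinate of `[x₁,…,xₙ]` is
`det(x₁,…,xₙ,eᵢ) = (-1)ⁿ det(eᵢ,x₁,…,xₙ)`. -/
noncomputable def bracketA (d : ℕ) : A d [⋀^Fin (d + 2)]→ₗ[ℂ] A d :=
  (-1 : ℂ) ^ (d + 2) •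
    AlternatingMap.pi fun i : Fin (d + 3) =>
      (Matrix.detRowAlternating (n := Fin (d + 3)) (R := ℂ)).curryLeft (e i)

theorem bracketA_apply {d : ℕ} (x : Fin (d + 2) → A d) (i : Fin (d + 3)) :
    bracketA d x i
      = (-1 : ℂ) ^ (d + 2) * Matrix.det (Matrix.of (Fin.cons (e i) x : Fin (d + 3) → A d)) := rfl

/-- `[e₁,…,êᵢ,…,eₙ₊₁] = (-1)^(n+i+1) eᵢ` with `i` counted from `1`, that is, `(-1)^(n+i) eᵢ` with
`i` counted from `0`. -/
theorem bracketA_basis {d : ℕ} (i : Fin (d + 3)) :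
    bracketA d (fun k => e (i.succAbove k)) = (-1 : ℂ) ^ (d + 2 + (i : ℕ)) • e i := by
  ext j
  rw [bracketA_apply]
  have key : (Matrix.of (Fin.cons (e j) (fun k => e (i.succAbove k)) :
      Fin (d + 3) → A d)).det = (-1 : ℂ) ^ (i : ℕ) * (e i : A d) j := by
    rw [Matrix.det_succ_row_zero, Finset.sum_eq_single j]
    · by_cases h : i = j
      · subst h
        have : (Matrix.of (Fin.cons (e i) (fun k => e (i.succAbove k)) :
            Fin (d + 3) → A d)).submatrix Fin.succ i.succAbove = 1 := by
          ext a b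
          simp [e, Matrix.one_apply, Pi.single_apply, eq_comm]
        rw [this]
        simp [e]
      · obtain ⟨k, hk⟩ := Fin.exists_succAbove_eq (Ne.symm h)
        have : ((Matrix.of (Fin.cons (e j) (fun k => e (i.succAbove k)) :
            Fin (d + 3) → A d)).submatrix Fin.succ j.succAbove).det = 0 := by
          apply Matrix.det_eq_zero_of_row_eq_zero k
          intro b
          simp [e, hk, Fin.succAbove_ne]
        rw [this]
        simp [e, Ne.symm h]
    · intro b _ hb
      simp [e, hb]
    · simp
  rw [key]
  simp [pow_add, mul_assoc]

/-- The Lie algebra `so(n+1)` of skew-symmetric complex matrices, `n = d + 2`. -/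
abbrev so (d : ℕ) : LieSubalgebra ℂ (Matrix (Fin (d + 3)) (Fin (d + 3)) ℂ) :=
  LieAlgebra.Orthogonal.so (Fin (d + 3)) ℂ

/-- The universal enveloping algebra of `so(n+1)`. -/
abbrev U (d : ℕ) : Type := UniversalEnvelopingAlgebra ℂ (so d)

/-- The canonical map `so(n+1) → U`. -/
abbrev ι (d : ℕ) : so d →ₗ⁅ℂ⁆ U d := UniversalEnvelopingAlgebra.ι ℂ

theorem bracketA_snoc_skew {d : ℕ} (a : Fin (d + 1) → A d) (i j : Fin (d + 3)) :
    bracketA d (Fin.snoc (α := fun _ => A d) a (e i)) j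
      = -bracketA d (Fin.snoc (α := fun _ => A d) a (e j)) i := by
  have h : ∀ i j : Fin (d + 3),
      (Matrix.of (Fin.cons (e j) (Fin.snoc (α := fun _ => A d) a (e i)) : Fin (d + 3) → A d)) =
      (Matrix.of (Fin.cons (e i) (Fin.snoc (α := fun _ => A d) a (e j)) :
        Fin (d + 3) → A d)).submatrix (Equiv.swap 0 (Fin.last (d + 2))) id := by
    intro i j
    ext r c
    simp only [Matrix.of_apply, Matrix.submatrix_apply, id]
    refine Fin.cases ?_ (fun r => ?_) r
    · rw [Equiv.swap_apply_left, ← Fin.succ_last]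
      simp
    · refine Fin.lastCases ?_ (fun r => ?_) r
      · rw [Fin.succ_last, Equiv.swap_apply_right, ← Fin.succ_last]
        simp
      · rw [Equiv.swap_apply_of_ne_of_ne (Fin.succ_ne_zero _)
          (by rw [← Fin.succ_last]; exact fun hh =>
            (Fin.castSucc_lt_last r).ne (Fin.succ_injective _ hh))]
        simp
  rw [bracketA_apply, bracketA_apply, h, Matrix.det_permute, Equiv.Perm.sign_swap
    (by simp [Fin.ext_iff])]
  simp

/-- The element `a₁ ∧ … ∧ aₙ₋₁` of the basic Lie algebra `∧^(n-1) A ≃ so(n+1)`. The identification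
is `ad`: the matrix is that of the inner derivation `b ↦ [a₁,…,aₙ₋₁,b]` of `A`. -/
noncomputable def basic {d : ℕ} (a : Fin (d + 1) → A d) : so d :=
  ⟨Matrix.of fun i j => bracketA d (Fin.snoc (α := fun _ => A d) a (e j)) i, by
    rw [mem_so]
    ext i j
    simpa using bracketA_snoc_skew a i j⟩

/-- `[a₁,…,aₙ] ∧ b₁ ∧ … ∧ bₙ₋₂ - ∑ᵢ (-1)^(i+n) (a₁ ∧ … âᵢ … ∧ aₙ)(aᵢ ∧ b₁ ∧ … ∧ bₙ₋₂)`,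
where `i` is counted from `1` in this formula and from `0` in the code. -/
noncomputable def generatorQ {d : ℕ} (a : Fin (d + 2) → A d) (b : Fin d → A d) : U d :=
  ι d (basic (Fin.cons (bracketA d a) b))
    - ∑ i : Fin (d + 2), (-1 : ℂ) ^ ((i : ℕ) + 1 + (d + 2)) •
        (ι d (basic (fun k => a (i.succAbove k))) * ι d (basic (Fin.cons (a i) b)))

/-- The two-sided ideal `Q(A)` of `U(so(n+1))`. -/
noncomputable def Q (d : ℕ) : TwoSidedIdeal (U d) :=
  TwoSidedIdeal.span {u | ∃ (a : Fin (d + 2) → A d) (b : Fin d → A d), u = generatorQ a b}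

/-! ### Cartan subalgebra, positive root vectors and the modules `Z(λ)` -/

/-- The element `u ∧ w = u wᵀ - w uᵀ` of `so(n+1) ≃ ∧² A`; thus
`e i ∧ e j = E_{ij} - E_{ji}`. -/
def wedge {d : ℕ} (u w : A d) : so d :=
  ⟨Matrix.vecMulVec u w - Matrix.vecMulVec w u, by
    rw [mem_so]
    ext i j
    simp [Matrix.vecMulVec_apply, mul_comm]⟩

/-- The rank `⌊(n+1)/2⌋` of `so(n+1)`. -/
abbrev rk (d : ℕ) : ℕ := (d + 3) / 2

/-- The basis vector written `e_{2j-1}` when indices start at `1`. -/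
def eOdd {d : ℕ} (j : Fin (rk d)) : A d := e ⟨2 * j, by have h : (j : ℕ) < (d + 3) / 2 := j.2; omega⟩

/-- The basis vector written `e_{2j}` when indices start at `1`. -/
def eEven {d : ℕ} (j : Fin (rk d)) : A d := e ⟨2 * j + 1, by have h : (j : ℕ) < (d + 3) / 2 := j.2; omega⟩

/-- `v_j = (e_{2j-1} - i e_{2j}) / √2`. -/
noncomputable def vPos {d : ℕ} (j : Fin (rk d)) : A d :=
  ((Real.sqrt 2 : ℝ) : ℂ)⁻¹ • (eOdd j - Complex.I • eEven j)

/-- `v_{-j} = (e_{2j-1} + i e_{2j}) / √2`. -/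
noncomputable def vNeg {d : ℕ} (j : Fin (rk d)) : A d :=
  ((Real.sqrt 2 : ℝ) : ℂ)⁻¹ • (eOdd j + Complex.I • eEven j)

/-- `ε_j = i (e_{2j-1} ∧ e_{2j})`. -/
noncomputable def eps {d : ℕ} (j : Fin (rk d)) : so d := Complex.I • wedge (eOdd j) (eEven j)

/-- The Cartan subalgebra `H = ⨁ ℂ ε_j`. -/
noncomputable def H (d : ℕ) : Submodule ℂ (so d) := Submodule.span ℂ (Set.range eps)

/-- `ε_j` as an element of `H`. -/
noncomputable def epsH {d : ℕ} (j : Fin (rk d)) : H d :=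
  ⟨eps j, Submodule.subset_span ⟨j, rfl⟩⟩

/-- The positive root vectors: `v_j ∧ v_k` and `v_j ∧ v_{-k}` for `j < k`, of roots `ε_j ± ε_k`,
and, if `n + 1` is odd, `v_0 ∧ v_j`, of root `ε_j`, where `v_0` is the last basis vector. -/
def posRootVectors (d : ℕ) : Set (so d) :=
  {X | ∃ j k : Fin (rk d), j < k ∧
      (X = wedge (vPos j) (vPos k) ∨ X = wedge (vPos j) (vNeg k))} ∪
  {X | Odd (d + 3) ∧ ∃ j : Fin (rk d), X = wedge (e (Fin.last (d + 2))) (vPos j)}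

/-- The left ideal `I(λ)` of `U`, generated by the positive root vectors and by all
`h - λ(h) 1` with `h ∈ H`; the Verma module of highest weight `λ` is `U / I(λ)`. -/
noncomputable def I {d : ℕ} (lam : Module.Dual ℂ (H d)) : Ideal (U d) :=
  Ideal.span ({u | ∃ X ∈ posRootVectors d, u = ι d X} ∪
    {u | ∃ h : H d, u = ι d h - algebraMap ℂ (U d) (lam h)})

/-- The largest proper left ideal `J(λ)` containing `I(λ)`, as the sum of all proper left ideals
containing `I(λ)`. -/
noncomputable def J {d : ℕ} (lam : Module.Dual ℂ (H d)) : Ideal (U d) :=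
  sSup {K : Ideal (U d) | I lam ≤ K ∧ K ≠ ⊤}

/-- The irreducible highest weight module `Z(λ) = U / J(λ)`. -/
abbrev Z {d : ℕ} (lam : Module.Dual ℂ (H d)) : Type := U d ⧸ J lam

/-- The `so(n+1)`-module `Z(λ)` is an irreducible module of the `n`-Lie algebra `A`: it carries an
irreducible `n`-Lie module structure for which the resulting action of the basic Lie algebra
`so(n+1)` is the given one. -/
def IsIrreducibleAModule {d : ℕ} (lam : Module.Dual ℂ (H d)) : Prop :=
  ∃ br : (A d × Z lam) [⋀^Fin (d + 2)]→ₗ[ℂ] (A d × Z lam),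
    IsIrreducibleNLieModule (bracketA d) br ∧
      ∀ (a : Fin (d + 1) → A d) (m : Z lam), nAction br a m = (0, ι d (basic a) • m)

/-! ### Fundamental weights -/

/-- The linear form on `H` sending `h = ∑ c_k ε_k` to `c_j`, read off from a matrix entry. -/
noncomputable def coord {d : ℕ} (j : Fin (rk d)) : Module.Dual ℂ (H d) where
  toFun h := -Complex.I *
    ((h : so d) : Matrix (Fin (d + 3)) (Fin (d + 3)) ℂ)
      ⟨2 * j, by have h : (j : ℕ) < (d + 3) / 2 := j.2; omega⟩ ⟨2 * j + 1, by have h : (j : ℕ) < (d + 3) / 2 := j.2; omega⟩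
  map_add' h h' := by simp [mul_add]
  map_smul' c h := by simp; ring

theorem coord_epsH {d : ℕ} (j k : Fin (rk d)) :
    coord j (epsH k) = if j = k then 1 else 0 := by
  by_cases h : j = k
  · subst h
    simp [coord, epsH, eps, wedge, eOdd, eEven, e, Matrix.vecMulVec_apply]
  · have h' : (j : ℕ) ≠ k := fun hh => h (Fin.ext hh)
    have h2 : ¬ (2 * (j : ℕ) = 2 * k + 1) := by omega
    simp [coord, epsH, eps, wedge, eOdd, eEven, e, Matrix.vecMulVec_apply, Pi.single_apply, h, h',
      h2]

/-- The coroot `α_k^∨` of the `k`-th simple root (`k` counted from `0`). The simple roots are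
`ε_k - ε_{k+1}` for all `k` but the last, and the last one is `ε_{N-1} + ε_N` for `so(2N)` and
`ε_N` for `so(2N+1)` (indices from `1`). -/
noncomputable def simpleCoroot {d : ℕ} (k : Fin (rk d)) : H d :=
  if h : (k : ℕ) + 1 < rk d then epsH k - epsH ⟨k + 1, h⟩
  else if Even (d + 3) then epsH ⟨k - 1, by have h : (k : ℕ) < (d + 3) / 2 := k.2; omega⟩ + epsH k
  else (2 : ℂ) • epsH k

/-- The fundamental weights `π_1, …, π_N` of `so(n+1)`, `N = ⌊(n+1)/2⌋`, and `π_0 = 0`: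
`π_k = ε_1 + … + ε_k`, except that `π_N = (ε_1 + … + ε_N)/2` and, for `so(2N)`,
`π_{N-1} = (ε_1 + … + ε_{N-1} - ε_N)/2`. -/
noncomputable def fundWeight (d : ℕ) (k : ℕ) : Module.Dual ℂ (H d) :=
  if k = rk d then (2 : ℂ)⁻¹ • ∑ j : Fin (rk d), coord j
  else if Even (d + 3) ∧ k + 1 = rk d then
    (2 : ℂ)⁻¹ • ∑ j : Fin (rk d), (if (j : ℕ) < k then (1 : ℂ) else -1) • coord j
  else ∑ j : Fin (rk d), (if (j : ℕ) < k then (1 : ℂ) else 0) • coord j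

theorem sum_coord_epsH {d : ℕ} (c : Fin (rk d) → ℂ) (k : Fin (rk d)) :
    (∑ j : Fin (rk d), c j • coord j) (epsH k) = c k := by
  simp [LinearMap.sum_apply, coord_epsH]

theorem sum_coord_epsH_one {d : ℕ} (k : Fin (rk d)) :
    (∑ j : Fin (rk d), coord j) (epsH k) = 1 := by
  simp [LinearMap.sum_apply, coord_epsH]

/-- The fundamental weights are dual to the simple coroots. -/
theorem fundWeight_simpleCoroot {d : ℕ} (hd : 1 ≤ d) (i k : Fin (rk d)) :
    fundWeight d ((i : ℕ) + 1) (simpleCoroot k) = if i = k then 1 else 0 := by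
  have hi : (i : ℕ) < rk d := i.2
  have hk : (k : ℕ) < rk d := k.2
  have hN : 2 ≤ rk d := by
    have : 2 ≤ (d + 3) / 2 := by omega
    exact this
  simp only [Fin.ext_iff]
  unfold fundWeight simpleCoroot
  split_ifs <;>
    simp only [map_add, map_sub, map_smul, LinearMap.smul_apply, sum_coord_epsH,
      sum_coord_epsH_one, smul_eq_mul] <;>
    (try split_ifs) <;> first | omega | (norm_num; done) | grind

/-- The weights of the classification, in terms of fundamental weights, for `1 ≤ t ≤ N`. -/
noncomputable def fundForm (d : ℕ) (t : ℕ) (x : ℂ) : Module.Dual ℂ (H d) :=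
  if Even (d + 3) then
    if t + 1 < rk d then (-1 - x) • fundWeight d (t - 1) + x • fundWeight d t
    else if t + 1 = rk d then
      (-1 - x) • fundWeight d (t - 1) + x • fundWeight d t + x • fundWeight d (t + 1)
    else (-1 - x) • fundWeight d (t - 1) + (-1 + x) • fundWeight d t
  else
    if t < rk d then (-1 - x) • fundWeight d (t - 1) + x • fundWeight d t
    else (-1 - x) • fundWeight d (t - 1) + (2 * x) • fundWeight d t

end NLie

/-! Proof of the classification of the irreducible highest weight modules of the simple `n`-Lie
algebra. -/

/-! The equivalence of the two module notions is a reading of the generalized Jacobi identity. The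
bracket on `A ⊕ M` is determined by the bracket of `A` and the action of the elements `basic a`. In
its `M`-component, the terms with the module entry among the `xᵢ` express that `M` is an
`so(n+1)`-module (`lie_basic`), and the terms with the module entry among the `yⱼ` express that the
generators of `Q(A)` kill `M`. Since the `basic a` span `so(n+1)`, and `so(n+1)` generates `U`, the
submodules are the same on both sides.

Necessity of the weight condition: Cramer's relation shows that a generator of `Q(A)` depends on `a`
only through `[a₁,…,aₙ]` (`generatorQ_eq`). Choosing this vector to be a basis vector and `b` a
complementary set of basis vectors gives, up to a nonzero scalar, the 4×4 Pfaffians in the `e_i ∧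
e_j` (`pfaffian_mem_Q`). On a highest weight vector the Pfaffian of the planes `j < k` acts by
`-λ_k(λ_j + 1)`, so this number must vanish.

Sufficiency: `so(n+1)` acts by the operators `z_u ∂_w - z_w ∂_u` of a Weyl algebra, and every such
representation kills `Q(A)`: after normal ordering, the terms of order two pair antisymmetric
coefficients with commuting operators (`WeylPair.repU_basicTail_eq`). In isotropic coordinates, the
monomial `z_t^x`, with the variables `z_j`, `j < t`, Fourier transformed, is a highest weight vector
of weight `(-1,…,-1,x,0,…,0)`. Its annihilator is a proper left ideal containing `I(λ)`, hence lies
in `J(λ)`. As `Q(A)` is two-sided, `Q(A) U ⊆ J(λ)`, and `Q(A)` kills `Z(λ)`. Whether the monomial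
module is irreducible plays no role.

It remains to see that `J(λ)`, a sum of proper left ideals, is itself proper. Modulo `I(λ)` each
element of `U` is a scalar plus terms of negative degree; a proper left ideal containing `I(λ)`
contains no element with nonzero scalar part. Hence all these ideals lie in one proper ideal,
defined by the coefficient of the base monomial (`le_coefficientIdeal`). This argument uses the
monomial module in place of the Poincaré–Birkhoff–Witt theorem. -/

namespace NLie

open LieAlgebra.Orthogonal

attribute [local instance] LieRing.ofAssociativeRing

/-! ### The inner derivations of the vector product -/

/-- Cramer's relation between `m + 1` vectors of an `m`-dimensional space. -/
theorem sum_det_succAbove_smul {m : ℕ} (F : Fin (m + 1) → Fin m → ℂ) :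
    -- Each coordinate of the sum is the expansion, along its first column, of a determinant in
    -- which that column is repeated.
    ∑ i : Fin (m + 1), ((-1 : ℂ) ^ (i : ℕ) * Matrix.det (Matrix.of fun k => F (i.succAbove k))) • F i = 0 := by
  ext j
  have h : (Matrix.of fun i => (Fin.cons (F i j) (F i) : Fin (m + 1) → ℂ)).det = 0 :=
    Matrix.det_zero_of_column_eq (Fin.succ_ne_zero j).symm (fun i => by simp)
  rw [Matrix.det_succ_column_zero] at h
  rw [Finset.sum_apply, Pi.zero_apply, ← h]
  refine Finset.sum_congr rfl fun i _ => ?_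
  have : ((Matrix.of fun i => (Fin.cons (F i j) (F i) : Fin (m + 1) → ℂ)).submatrix
      i.succAbove Fin.succ) = Matrix.of fun k => F (i.succAbove k) := by
    ext a b; simp
  rw [this]
  simp only [Pi.smul_apply, smul_eq_mul, Matrix.of_apply, Fin.cons_zero]
  ring

/-- The entries of `basic`, as alternating forms. -/
noncomputable def basicEntry {d : ℕ} (r s : Fin (d + 3)) : A d [⋀^Fin (d + 1)]→ₗ[ℂ] ℂ :=
  -(((Matrix.detRowAlternating (n := Fin (d + 3)) (R := ℂ)).curryLeft (e r)).curryLeft (e s))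

theorem basicEntry_apply {d : ℕ} (r s : Fin (d + 3)) (c : Fin (d + 1) → A d) :
    basicEntry r s c
      = -Matrix.det (Matrix.of (Fin.cons (e r) (Fin.cons (e s) c : Fin (d + 2) → A d) :
          Fin (d + 3) → A d)) := rfl

theorem bracketA_snoc {d : ℕ} (c : Fin (d + 1) → A d) (u : A d) :
    bracketA d (Fin.snoc (α := fun _ => A d) c u) =
      (-1 : ℂ) ^ (d + 1) • bracketA d (Fin.cons u c) := by
  have h := (bracketA d).map_insertNth (Fin.last (d + 1)) u c
  rw [Fin.insertNth_last'] at h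
  rw [h]
  simp only [Fin.val_last]
  rw [← Int.cast_smul_eq_zsmul ℂ]
  push_cast
  rfl

theorem basic_apply {d : ℕ} (c : Fin (d + 1) → A d) (r s : Fin (d + 3)) :
    (basic c : Matrix (Fin (d + 3)) (Fin (d + 3)) ℂ) r s = basicEntry r s c := by
  change bracketA d (Fin.snoc (α := fun _ => A d) c (e s)) r = _
  rw [bracketA_snoc, Pi.smul_apply, bracketA_apply, basicEntry_apply, smul_eq_mul, ← mul_assoc,
    ← pow_add]
  rw [show d + 1 + (d + 2) = 2 * (d + 1) + 1 by ring, pow_succ, pow_mul]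
  simp

/-- The first slot of an alternating map, as a linear map. -/
def consLinear {k : ℕ} {V W : Type*} [AddCommGroup V] [Module ℂ V] [AddCommGroup W] [Module ℂ W]
    (f : V [⋀^Fin (k + 1)]→ₗ[ℂ] W) (c : Fin k → V) : V →ₗ[ℂ] W where
  toFun u := f (Fin.cons u c)
  map_add' x y := by
    change f.curryLeft (x + y) c = f.curryLeft x c + f.curryLeft y c
    rw [map_add, AlternatingMap.add_apply]
  map_smul' t x := by
    change f.curryLeft (t • x) c = t • f.curryLeft x c
    rw [map_smul, AlternatingMap.smul_apply]

@[simp]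
theorem consLinear_apply {k : ℕ} {V W : Type*} [AddCommGroup V] [Module ℂ V] [AddCommGroup W]
    [Module ℂ W] (f : V [⋀^Fin (k + 1)]→ₗ[ℂ] W) (c : Fin k → V) (u : V) :
    consLinear f c u = f (Fin.cons u c) := rfl

theorem eq_sum_smul_e {d : ℕ} (v : A d) : v = ∑ s, v s • e s := by
  ext i; simp [e, Finset.sum_apply, Pi.single_apply]

theorem basic_mulVec {d : ℕ} (c : Fin (d + 1) → A d) (v : A d) :
    (basic c : Matrix (Fin (d + 3)) (Fin (d + 3)) ℂ).mulVec v =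
      bracketA d (Fin.snoc (α := fun _ => A d) c v) := by
  rw [bracketA_snoc, ← consLinear_apply]
  conv_rhs => rw [eq_sum_smul_e v, map_sum, Finset.smul_sum]
  rw [Matrix.mulVec_eq_sum]
  refine Finset.sum_congr rfl fun s _ => ?_
  have h : Matrix.transpose (basic c : Matrix (Fin (d + 3)) (Fin (d + 3)) ℂ) s =
      (-1 : ℂ) ^ (d + 1) • bracketA d (Fin.cons (e s) c) := bracketA_snoc c (e s)
  rw [h, map_smul, consLinear_apply, smul_comm]
  simp

/-- `basic` as an alternating map. -/
noncomputable def basicAlt (d : ℕ) : A d [⋀^Fin (d + 1)]→ₗ[ℂ] so d where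
  toFun := basic
  map_update_add' c i x y := by
    ext r s
    have := (basicEntry r s).map_update_add c i x y
    rw [AddMemClass.coe_add, Matrix.add_apply, basic_apply, basic_apply, basic_apply]
    convert this
  map_update_smul' c i t x := by
    ext r s
    have := (basicEntry r s).map_update_smul c i t x
    rw [SetLike.val_smul, Matrix.smul_apply, basic_apply, basic_apply]
    convert this
  map_eq_zero_of_eq' c i j h hij := by
    ext r s
    simpa [basic_apply] using (basicEntry r s).map_eq_zero_of_eq c h hij

theorem basicAlt_apply {d : ℕ} (c : Fin (d + 1) → A d) : basicAlt d c = basic c := rfl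

theorem neg_one_pow_eq {k l : ℕ} (h : k % 2 = l % 2) : (-1 : ℂ) ^ k = (-1) ^ l := by
  rw [← Nat.div_add_mod k 2, ← Nat.div_add_mod l 2, h]
  simp [pow_add, pow_mul]

/-- This is Cramer's relation for the `n + 2` vectors `e_r, e_s, a₁, …, aₙ` of `ℂ^(n+1)`: the
coefficients of `e_r` and `e_s` are coordinates of `[a₁,…,aₙ]`, those of the `a_i` are matrix
entries of `a₁ ∧ … âᵢ … ∧ aₙ`. -/
theorem sum_basicEntry_smul {d : ℕ} (a : Fin (d + 2) → A d) (r s : Fin (d + 3)) :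
    ∑ i : Fin (d + 2), ((-1 : ℂ) ^ ((i : ℕ) + 1 + (d + 2)) *
      basicEntry r s (fun k => a (i.succAbove k))) • a i
      = bracketA d a r • e s - bracketA d a s • e r := by
  have h := sum_det_succAbove_smul
    (Fin.cons (e r) (Fin.cons (e s) a : Fin (d + 3) → A d) : Fin (d + 4) → A d)
  rw [Fin.sum_univ_succ, Fin.sum_univ_succ] at h
  have h0 : (Matrix.of fun k => (Fin.cons (e r) (Fin.cons (e s) a : Fin (d + 3) → A d) :
      Fin (d + 4) → A d) ((0 : Fin (d + 4)).succAbove k))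
      = Matrix.of (Fin.cons (e s) a : Fin (d + 3) → A d) := by
    refine congrArg Matrix.of (funext fun k => ?_)
    rw [Fin.zero_succAbove, Fin.cons_succ]
  have h1 : (Matrix.of fun k => (Fin.cons (e r) (Fin.cons (e s) a : Fin (d + 3) → A d) :
      Fin (d + 4) → A d) ((Fin.succ 0 : Fin (d + 4)).succAbove k))
      = Matrix.of (Fin.cons (e r) a : Fin (d + 3) → A d) := by
    refine congrArg Matrix.of (funext fun k => ?_)
    refine Fin.cases ?_ (fun k => ?_) k
    · rw [Fin.succ_succAbove_zero, Fin.cons_zero, Fin.cons_zero]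
    · rw [Fin.succ_succAbove_succ, Fin.zero_succAbove, Fin.cons_succ, Fin.cons_succ, Fin.cons_succ]
  have h2 : ∀ i : Fin (d + 2), (Matrix.of fun k => (Fin.cons (e r) (Fin.cons (e s) a :
      Fin (d + 3) → A d) : Fin (d + 4) → A d) ((i.succ.succ : Fin (d + 4)).succAbove k))
      = Matrix.of (Fin.cons (e r) (Fin.cons (e s) (fun k => a (i.succAbove k)) :
        Fin (d + 2) → A d) : Fin (d + 3) → A d) := by
    intro i
    refine congrArg Matrix.of (funext fun k => ?_)
    refine Fin.cases ?_ (fun k => ?_) k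
    · rw [Fin.succ_succAbove_zero, Fin.cons_zero, Fin.cons_zero]
    · rw [Fin.succ_succAbove_succ, Fin.cons_succ, Fin.cons_succ]
      refine Fin.cases ?_ (fun k => ?_) k
      · rw [Fin.succ_succAbove_zero, Fin.cons_zero, Fin.cons_zero]
      · rw [Fin.succ_succAbove_succ, Fin.cons_succ, Fin.cons_succ]
  rw [h0, h1] at h
  simp only [h2] at h
  have hb : ∀ r, (-1 : ℂ) ^ (d + 2) * bracketA d a r =
      Matrix.det (Matrix.of (Fin.cons (e r) a : Fin (d + 3) → A d)) := by
    intro r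
    rw [bracketA_apply, ← mul_assoc, ← pow_add, ← two_mul, pow_mul]; simp
  rw [← hb, ← hb] at h
  have hs : (-1 : ℂ) ^ (d + 2) * (-1 : ℂ) ^ (d + 2) = 1 := by
    rw [← pow_add, ← two_mul, pow_mul]; simp
  have h' := congrArg (fun z => ((-1 : ℂ) ^ (d + 2)) • z) h
  simp only [smul_add, smul_smul, smul_zero, Fin.val_zero, Fin.val_succ, Fin.cons_zero,
    Fin.cons_succ, Finset.smul_sum] at h'
  have h3 : ∀ i : Fin (d + 2), ((-1 : ℂ) ^ ((i : ℕ) + 1 + (d + 2)) *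
      basicEntry r s (fun k => a (i.succAbove k))) • a i =
      ((-1 : ℂ) ^ (d + 2) * ((-1 : ℂ) ^ ((i : ℕ) + 1 + 1) *
      (Matrix.of (Fin.cons (e r) (Fin.cons (e s) (fun k => a (i.succAbove k)) :
        Fin (d + 2) → A d) : Fin (d + 3) → A d)).det)) • a i := by
    intro i
    rw [basicEntry_apply]
    congr 1
    ring
  rw [Finset.sum_congr rfl fun i _ => h3 i]
  rw [eq_sub_iff_add_eq', ← sub_eq_zero, ← h']
  have e1 : (-1 : ℂ) ^ (d + 2) * ((-1) ^ 0 * ((-1) ^ (d + 2) * bracketA d a s)) =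
      bracketA d a s := by linear_combination bracketA d a s * hs
  have e2 : (-1 : ℂ) ^ (d + 2) * ((-1) ^ (0 + 1) * ((-1) ^ (d + 2) * bracketA d a r)) =
      - bracketA d a r := by linear_combination - bracketA d a r * hs
  rw [e1, e2]
  module

/-! ### The wedge product -/

theorem wedge_apply {d : ℕ} (u w : A d) (i j : Fin (d + 3)) :
    (wedge u w : Matrix (Fin (d + 3)) (Fin (d + 3)) ℂ) i j = u i * w j - w i * u j := rfl

/-- `wedge` as a bilinear map. -/
noncomputable def wedgeBilin (d : ℕ) : A d →ₗ[ℂ] A d →ₗ[ℂ] so d :=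
  LinearMap.mk₂ ℂ wedge
    (fun u u' w => by
      ext i j
      rw [AddMemClass.coe_add, Matrix.add_apply]
      simp only [wedge_apply, Pi.add_apply]; ring)
    (fun c u w => by
      ext i j
      rw [SetLike.val_smul, Matrix.smul_apply]
      simp only [wedge_apply, Pi.smul_apply, smul_eq_mul]; ring)
    (fun u w w' => by
      ext i j
      rw [AddMemClass.coe_add, Matrix.add_apply]
      simp only [wedge_apply, Pi.add_apply]; ring)
    (fun c u w => by
      ext i j
      rw [SetLike.val_smul, Matrix.smul_apply]
      simp only [wedge_apply, Pi.smul_apply, smul_eq_mul]; ring)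

theorem wedgeBilin_apply {d : ℕ} (u w : A d) : wedgeBilin d u w = wedge u w := rfl

theorem wedge_swap {d : ℕ} (u w : A d) : wedge w u = -wedge u w := by
  ext i j
  rw [NegMemClass.coe_neg, Matrix.neg_apply]
  simp only [wedge_apply]; ring

theorem wedge_self {d : ℕ} (u : A d) : wedge u u = 0 := by
  ext i j
  rw [wedge_apply]; simp

theorem so_apply_swap {d : ℕ} (X : so d) (i j : Fin (d + 3)) :
    (X : Matrix (Fin (d + 3)) (Fin (d + 3)) ℂ) j i = -(X : Matrix _ _ ℂ) i j := by
  have := (mem_so _ _ _).1 X.2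
  exact congrFun (congrFun this i) j

theorem so_eq_sum {d : ℕ} (X : so d) :
    X = (2 : ℂ)⁻¹ • ∑ r, ∑ s, (X : Matrix (Fin (d + 3)) (Fin (d + 3)) ℂ) r s •
      wedge (e r) (e s) := by
  ext i j
  rw [SetLike.val_smul, Matrix.smul_apply, AddSubmonoidClass.coe_finsetSum, Matrix.sum_apply]
  simp only [AddSubmonoidClass.coe_finsetSum, Matrix.sum_apply, SetLike.val_smul,
    Matrix.smul_apply, wedge_apply, e, Pi.single_apply, smul_eq_mul, mul_sub,
    Finset.sum_sub_distrib]
  have h := so_apply_swap X i j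
  simp [h]
  ring

/-- The action of `u ∧ w` on vectors. -/
theorem wedge_mulVec {d : ℕ} (u w v : A d) :
    (wedge u w : Matrix (Fin (d + 3)) (Fin (d + 3)) ℂ).mulVec v =
      (w ⬝ᵥ v) • u - (u ⬝ᵥ v) • w := by
  ext i
  simp only [Matrix.mulVec, dotProduct, wedge_apply, Pi.sub_apply, Pi.smul_apply, smul_eq_mul,
    sub_mul, Finset.sum_sub_distrib, Finset.sum_mul]
  congr 1 <;> exact Finset.sum_congr rfl fun _ _ => by ring

theorem lie_wedge {d : ℕ} (X : so d) (u w : A d) :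
    ⁅X, wedge u w⁆ = wedge ((X : Matrix (Fin (d + 3)) (Fin (d + 3)) ℂ).mulVec u) w +
      wedge u ((X : Matrix (Fin (d + 3)) (Fin (d + 3)) ℂ).mulVec w) := by
  ext i j
  rw [LieSubalgebra.coe_bracket, Ring.lie_def, AddMemClass.coe_add, Matrix.add_apply,
    Matrix.sub_apply, Matrix.mul_apply, Matrix.mul_apply]
  simp only [Matrix.mulVec, dotProduct, wedge_apply, mul_sub, sub_mul, Finset.sum_sub_distrib,
    Finset.sum_mul, Finset.mul_sum]
  have h : ∀ x, (X : Matrix (Fin (d + 3)) (Fin (d + 3)) ℂ) x j = -(X : Matrix _ _ ℂ) j x :=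
    fun x => so_apply_swap X j x
  simp only [h, mul_neg, Finset.sum_neg_distrib]
  have e1 : ∀ f g : Fin (d + 3) → ℂ, (∀ x, f x = g x) → ∑ x, f x = ∑ x, g x :=
    fun f g h => Finset.sum_congr rfl fun x _ => h x
  rw [e1 (fun x => (X : Matrix (Fin (d + 3)) (Fin (d + 3)) ℂ) i x * (u x * w j))
      (fun x => (X : Matrix (Fin (d + 3)) (Fin (d + 3)) ℂ) i x * u x * w j) (fun _ => by ring),
    e1 (fun x => (X : Matrix (Fin (d + 3)) (Fin (d + 3)) ℂ) i x * (w x * u j))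
      (fun x => (X : Matrix (Fin (d + 3)) (Fin (d + 3)) ℂ) i x * w x * u j) (fun _ => by ring),
    e1 (fun x => u i * w x * (X : Matrix (Fin (d + 3)) (Fin (d + 3)) ℂ) j x)
      (fun x => u i * ((X : Matrix (Fin (d + 3)) (Fin (d + 3)) ℂ) j x * w x)) (fun _ => by ring),
    e1 (fun x => w i * u x * (X : Matrix (Fin (d + 3)) (Fin (d + 3)) ℂ) j x)
      (fun x => w i * ((X : Matrix (Fin (d + 3)) (Fin (d + 3)) ℂ) j x * u x)) (fun _ => by ring)]
  ring

/-- The wedge product with a vector product, in terms of the basic Lie algebra. -/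
theorem sum_smul_basic_eq_wedge {d : ℕ} (a : Fin (d + 2) → A d) (u : A d) :
    ∑ i : Fin (d + 2), ((-1 : ℂ) ^ ((i : ℕ) + 1 + (d + 2)) * (a i ⬝ᵥ u)) •
      basic (fun k => a (i.succAbove k)) = wedge (bracketA d a) u := by
  ext r s
  have h := congrArg (fun v : A d => v ⬝ᵥ u) (sum_basicEntry_smul a r s)
  simp only [sum_dotProduct, smul_dotProduct, sub_dotProduct] at h
  have h1 : ∀ r, e r ⬝ᵥ u = u r := fun r => by simp [e]
  rw [h1, h1] at h
  rw [AddSubmonoidClass.coe_finsetSum, Matrix.sum_apply, wedge_apply]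
  simp only [SetLike.val_smul, Matrix.smul_apply, basic_apply, smul_eq_mul] at h ⊢
  rw [mul_comm (u r), ← h]
  exact Finset.sum_congr rfl fun _ _ => by ring

/-- `u ↦ u ∧ b₁ ∧ … ∧ bₙ₋₂` as a linear map to `U`. -/
noncomputable def basicTail {d : ℕ} (b : Fin d → A d) : A d →ₗ[ℂ] U d :=
  (ι d : so d →ₗ[ℂ] U d) ∘ₗ consLinear (basicAlt d) b

theorem basicTail_apply {d : ℕ} (b : Fin d → A d) (u : A d) :
    basicTail b u = ι d (basic (Fin.cons u b)) := rfl

/-- Expanding the left factors in the `e_r ∧ e_s` makes the sum over `i` an instance of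
`sum_basicEntry_smul`. The vectors `a` then enter only through their bracket, which can be
prescribed; this form serves both the Pfaffians and the Weyl algebra. -/
theorem generatorQ_eq {d : ℕ} (a : Fin (d + 2) → A d) (b : Fin d → A d) :
    generatorQ a b = basicTail b (bracketA d a) -
      ∑ r, ∑ s, bracketA d a r • (ι d (wedge (e r) (e s)) * basicTail b (e s)) := by
  unfold generatorQ
  rw [← basicTail_apply]
  congr 1
  have h1 : ∀ i : Fin (d + 2), (-1 : ℂ) ^ ((i : ℕ) + 1 + (d + 2)) •
      (ι d (basic (fun k => a (i.succAbove k))) * ι d (basic (Fin.cons (a i) b))) =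
      ∑ r, ∑ s, (2 : ℂ)⁻¹ • (ι d (wedge (e r) (e s)) *
        basicTail b (((-1 : ℂ) ^ ((i : ℕ) + 1 + (d + 2)) *
          basicEntry r s (fun k => a (i.succAbove k))) • a i)) := by
    intro i
    rw [← basicTail_apply]
    conv_lhs => rw [so_eq_sum (basic fun k => a (i.succAbove k))]
    simp only [map_smul, map_sum, basic_apply, Finset.smul_sum, Finset.sum_mul, smul_mul_assoc,
      mul_smul_comm, smul_smul]
    refine Finset.sum_congr rfl fun r _ => Finset.sum_congr rfl fun s _ => ?_
    congr 1; ring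
  rw [Finset.sum_congr rfl fun i _ => h1 i, Finset.sum_comm]
  have h2 : ∀ r, ∑ i : Fin (d + 2), ∑ s, (2 : ℂ)⁻¹ • (ι d (wedge (e r) (e s)) *
        basicTail b (((-1 : ℂ) ^ ((i : ℕ) + 1 + (d + 2)) *
          basicEntry r s (fun k => a (i.succAbove k))) • a i)) =
      ∑ s, (2 : ℂ)⁻¹ • (bracketA d a r • (ι d (wedge (e r) (e s)) * basicTail b (e s)) +
        bracketA d a s • (ι d (wedge (e s) (e r)) * basicTail b (e r))) := by
    intro r
    rw [Finset.sum_comm]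
    refine Finset.sum_congr rfl fun s _ => ?_
    rw [← Finset.smul_sum, ← Finset.mul_sum, ← map_sum, sum_basicEntry_smul, map_sub, mul_sub,
      map_smul, map_smul, mul_smul_comm, mul_smul_comm, wedge_swap (e r) (e s), map_neg, neg_mul,
      smul_neg, sub_eq_add_neg]
  rw [Finset.sum_congr rfl fun r _ => h2 r]
  simp only [smul_add, Finset.sum_add_distrib]
  -- The two terms are exchanged by swapping `r` and `s`, so their sums agree and the factor 1/2
  -- disappears.
  rw [Finset.sum_comm (f := fun r s => (2 : ℂ)⁻¹ • bracketA d a s •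
    (ι d (wedge (e s) (e r)) * basicTail b (e r))), ← Finset.sum_add_distrib]
  refine Finset.sum_congr rfl fun r _ => ?_
  rw [← Finset.sum_add_distrib]
  refine Finset.sum_congr rfl fun s _ => ?_
  rw [← add_smul]; norm_num

/-! ### Skew-symmetric matrices are derivations of the vector product -/

/-- Infinitesimal multiplicativity of the determinant: expanding each summand along its replaced row
yields the trace of `adjugate M * M * Xᵀ`. -/
theorem sum_det_updateRow {m : Type*} [Fintype m] [DecidableEq m] (M X : Matrix m m ℂ) :
    ∑ i, (M.updateRow i (X.mulVec (M i))).det = X.trace * M.det := by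
  have h : ∀ i, (M.updateRow i (X.mulVec (M i))).det =
      ∑ k, M.adjugate k i * X.mulVec (M i) k := by
    intro i
    rw [← Matrix.cramer_transpose_apply, Matrix.cramer_eq_adjugate_mulVec, ← Matrix.adjugate_transpose]
    rfl
  have h3 : X.trace * M.det = (M.adjugate * M * X.transpose).trace := by
    rw [Matrix.adjugate_mul, Matrix.smul_mul, Matrix.one_mul, Matrix.trace_smul,
      Matrix.trace_transpose, smul_eq_mul, mul_comm]
  rw [h3, Matrix.mul_assoc, Matrix.trace]
  simp only [h]
  rw [Finset.sum_comm]
  refine Finset.sum_congr rfl fun k _ => ?_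
  rw [Matrix.diag_apply, Matrix.mul_apply]
  refine Finset.sum_congr rfl fun i _ => ?_
  rw [Matrix.mul_apply]
  congr 1
  exact Finset.sum_congr rfl fun l _ => by rw [Matrix.transpose_apply, mul_comm]

theorem trace_so {d : ℕ} (X : so d) :
    (X : Matrix (Fin (d + 3)) (Fin (d + 3)) ℂ).trace = 0 := by
  refine Finset.sum_eq_zero fun i _ => ?_
  have := so_apply_swap X i i
  rw [Matrix.diag_apply]
  linear_combination this / 2

/-- Apply `sum_det_updateRow` to the rows `e_r, x₁, …, xₙ`. The trace of `X` is zero, and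
skew-symmetry turns the term with `X e_r` into the `r`-th coordinate of `X [x₁,…,xₙ]`, up to sign.
-/
theorem mulVec_bracketA {d : ℕ} (X : so d) (x : Fin (d + 2) → A d) :
    (X : Matrix (Fin (d + 3)) (Fin (d + 3)) ℂ).mulVec (bracketA d x) =
      ∑ i, bracketA d (Function.update x i
        ((X : Matrix (Fin (d + 3)) (Fin (d + 3)) ℂ).mulVec (x i))) := by
  ext r
  have h := sum_det_updateRow (Matrix.of (Fin.cons (e r) x : Fin (d + 3) → A d))
    (X : Matrix (Fin (d + 3)) (Fin (d + 3)) ℂ)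
  rw [trace_so, zero_mul, Fin.sum_univ_succ] at h
  have h0 : (Matrix.of (Fin.cons (e r) x : Fin (d + 3) → A d)).updateRow 0
      ((X : Matrix (Fin (d + 3)) (Fin (d + 3)) ℂ).mulVec
        ((Matrix.of (Fin.cons (e r) x : Fin (d + 3) → A d)) 0)) =
      Matrix.of (Fin.cons ((X : Matrix (Fin (d + 3)) (Fin (d + 3)) ℂ).mulVec (e r)) x :
        Fin (d + 3) → A d) := by
    change Function.update (Fin.cons (e r) x : Fin (d + 3) → A d) 0 _ = _
    rw [Fin.update_cons_zero]; rfl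
  have h1 : ∀ i : Fin (d + 2), (Matrix.of (Fin.cons (e r) x : Fin (d + 3) → A d)).updateRow i.succ
      ((X : Matrix (Fin (d + 3)) (Fin (d + 3)) ℂ).mulVec
        ((Matrix.of (Fin.cons (e r) x : Fin (d + 3) → A d)) i.succ)) =
      Matrix.of (Fin.cons (e r) (Function.update x i
        ((X : Matrix (Fin (d + 3)) (Fin (d + 3)) ℂ).mulVec (x i))) : Fin (d + 3) → A d) := by
    intro i
    change Function.update (Fin.cons (e r) x : Fin (d + 3) → A d) i.succ _ = _
    rw [Fin.cons_update]; rfl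
  rw [h0] at h
  simp only [h1] at h
  rw [Finset.sum_apply]
  simp only [bracketA_apply]
  rw [← Finset.mul_sum, eq_neg_of_add_eq_zero_right h]
  have h2 : (X : Matrix (Fin (d + 3)) (Fin (d + 3)) ℂ).mulVec (e r) =
      ∑ s, -(X : Matrix (Fin (d + 3)) (Fin (d + 3)) ℂ) r s • e s := by
    ext s
    rw [Finset.sum_apply]
    simp [e, Pi.single_apply, so_apply_swap X r s]
  have h3 : ∀ u : A d, Matrix.det (Matrix.of (Fin.cons u x : Fin (d + 3) → A d)) =
      consLinear (Matrix.detRowAlternating (n := Fin (d + 3)) (R := ℂ)) x u := fun _ => rfl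
  rw [h3, h2, map_sum]
  simp only [map_smul, smul_eq_mul]
  simp only [← h3, Matrix.mulVec, dotProduct, bracketA_apply, neg_mul,
    Finset.sum_neg_distrib, neg_neg, Finset.mul_sum]
  exact Finset.sum_congr rfl fun _ _ => by ring

/-- Evaluated on a vector `v`, this is the derivation property for `[c, v]` with the term where `X`
hits `v` moved to the commutator. -/
theorem lie_basic {d : ℕ} (X : so d) (c : Fin (d + 1) → A d) :
    ⁅X, basic c⁆ = ∑ l, basic (Function.update c l
      ((X : Matrix (Fin (d + 3)) (Fin (d + 3)) ℂ).mulVec (c l))) := by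
  apply Subtype.ext
  apply Matrix.ext_of_mulVec_single
  intro i
  rw [LieSubalgebra.coe_bracket, Ring.lie_def, Matrix.sub_mulVec, ← Matrix.mulVec_mulVec,
    ← Matrix.mulVec_mulVec, basic_mulVec, basic_mulVec, mulVec_bracketA, Fin.sum_univ_castSucc]
  simp only [Fin.snoc_castSucc, Fin.snoc_last]
  rw [Fin.update_snoc_last, add_sub_cancel_right, AddSubmonoidClass.coe_finsetSum,
    Matrix.sum_mulVec]
  refine Finset.sum_congr rfl fun l _ => ?_
  rw [basic_mulVec, Fin.snoc_update]

theorem bracketA_cons {d : ℕ} (u : A d) (c : Fin (d + 1) → A d) :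
    bracketA d (Fin.cons u c) =
      (-1 : ℂ) ^ (d + 1) • (basic c : Matrix (Fin (d + 3)) (Fin (d + 3)) ℂ).mulVec u := by
  rw [basic_mulVec, bracketA_snoc, smul_smul, ← pow_add, ← two_mul, pow_mul]
  simp

theorem isNLieBracket_bracketA (d : ℕ) : IsNLieBracket (bracketA d) := by
  intro x y
  simp only [bracketA_cons]
  rw [mulVec_bracketA, Finset.smul_sum]
  refine Finset.sum_congr rfl fun i _ => ?_
  rw [AlternatingMap.map_update_smul]

/-! ### Induction in the enveloping algebra -/

/-- The subalgebra `S` generated by `so(n+1)` is all of `U`, because the universal property gives a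
section of its inclusion. -/
theorem mem_of_ι_mul_mem {d : ℕ} (T : Submodule ℂ (U d)) (h1 : 1 ∈ T)
    (h : ∀ X, ∀ t ∈ T, ι d X * t ∈ T) (u : U d) : u ∈ T := by
  let S : Subalgebra ℂ (U d) := Algebra.adjoin ℂ (Set.range (ι d))
  have hS : ∀ u, u ∈ S := by
    let g : so d →ₗ⁅ℂ⁆ S :=
      { toFun := fun X => ⟨ι d X, Algebra.subset_adjoin ⟨X, rfl⟩⟩
        map_add' := fun X Y => by ext; simp
        map_smul' := fun c X => by ext; simp
        map_lie' := fun {X Y} => by ext; simp [Ring.lie_def] }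
    have hid : S.val.comp (UniversalEnvelopingAlgebra.lift ℂ g) = AlgHom.id ℂ (U d) := by
      apply UniversalEnvelopingAlgebra.hom_ext
      ext X
      simp [g]
    intro u
    have := DFunLike.congr_fun hid u
    rw [← AlgHom.id_apply (R := ℂ) u, ← this]
    exact (UniversalEnvelopingAlgebra.lift ℂ g u).2
  have key : ∀ t ∈ T, u * t ∈ T := by
    refine Algebra.adjoin_induction (p := fun u _ => ∀ t ∈ T, u * t ∈ T) ?_ ?_ ?_ ?_ (hS u)
    · rintro _ ⟨X, rfl⟩ t ht
      exact h X t ht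
    · intro c t ht
      rw [← Algebra.smul_def]
      exact T.smul_mem c ht
    · intro x y _ _ hx hy t ht
      rw [add_mul]
      exact T.add_mem (hx t ht) (hy t ht)
    · intro x y _ _ hx hy t ht
      rw [mul_assoc]
      exact hx _ (hy t ht)
  simpa using key 1 h1

theorem exists_bracketA_eq {d : ℕ} (r : Fin (d + 3)) :
    ∃ a : Fin (d + 2) → A d, bracketA d a = e r := by
  refine ⟨Function.update (fun k => e (r.succAbove k)) 0
    ((-1 : ℂ) ^ (d + 2 + (r : ℕ)) • e (r.succAbove 0)), ?_⟩
  rw [AlternatingMap.map_update_smul, Function.update_eq_self, bracketA_basis, smul_smul,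
    ← pow_add, ← two_mul, pow_mul]
  simp

/-- Every basis vector is a bracket, so every `e_r ∧ e_s` is a combination of elements `basic a` by
`sum_smul_basic_eq_wedge`. Stability under the `n`-ary action therefore implies stability under
`so(n+1)`. -/
theorem mem_span_basic {d : ℕ} (X : so d) : X ∈ Submodule.span ℂ (Set.range (basic (d := d))) := by
  rw [so_eq_sum X]
  refine Submodule.smul_mem _ _ (Submodule.sum_mem _ fun r _ => Submodule.sum_mem _ fun s _ =>
    Submodule.smul_mem _ _ ?_)
  obtain ⟨a, ha⟩ := exists_bracketA_eq r
  rw [← ha, ← sum_smul_basic_eq_wedge]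
  exact Submodule.sum_mem _ fun i _ => Submodule.smul_mem _ _ (Submodule.subset_span ⟨_, rfl⟩)

/-! ### `n`-Lie modules as modules of the enveloping algebra -/

section Module

variable {d : ℕ} {M : Type*} [AddCommGroup M] [Module ℂ M] [Module (U d) M]

theorem neg_one_pow_mul_self (k : ℕ) : (-1 : ℂ) ^ k * (-1) ^ k = 1 := by
  rw [← pow_add, ← two_mul, pow_mul]; simp

/-- Moving the module entry from the last slot to slot `p` costs the sign `(-1)^(p+n)`, with `p`
counted from one: this is the sign in the generators of `Q(A)`. -/
theorem br_insertNth {br : (A d × M) [⋀^Fin (d + 2)]→ₗ[ℂ] (A d × M)}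
    (hact : ∀ (a : Fin (d + 1) → A d) (m : M), nAction br a m = (0, ι d (basic a) • m))
    (p : Fin (d + 2)) (m : M) (c : Fin (d + 1) → A d) :
    br (p.insertNth (α := fun _ => A d × M) ((0 : A d), m) (fun k => (c k, (0 : M)))) =
      (-1 : ℂ) ^ ((p : ℕ) + 1 + (d + 2)) • ((0 : A d), ι d (basic c) • m) := by
  have h0 := hact c m
  unfold nAction at h0
  rw [← Fin.insertNth_last', br.map_insertNth, ← Int.cast_smul_eq_zsmul ℂ] at h0
  rw [br.map_insertNth, ← h0, ← Int.cast_smul_eq_zsmul ℂ, smul_smul]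
  congr 1
  push_cast
  rw [← pow_add]
  exact neg_one_pow_eq (by omega)

theorem smul_eq_zero_of_mem_Q [IsScalarTower ℂ (U d) M]
    (h : ∀ a b, ∀ m : M, generatorQ (d := d) a b • m = 0) : ∀ q ∈ Q d, ∀ m : M, q • m = 0 := by
  have hle : Q d ≤ TwoSidedIdeal.ker (Module.toAddMonoidEnd (U d) M) := by
    refine TwoSidedIdeal.span_le.2 ?_
    rintro _ ⟨a, b, rfl⟩
    refine (TwoSidedIdeal.mem_ker _).2 (AddMonoidHom.ext fun m => h a b m)
  intro q hq m
  exact DFunLike.congr_fun ((TwoSidedIdeal.mem_ker _).1 (hle hq)) m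

/-- The generator measures the failure of the Jacobi identity for `x = a` and `y = (m, b₁, …,
bₙ₋₂)`. -/
theorem generatorQ_smul_eq_zero [IsScalarTower ℂ (U d) M]
    {br : (A d × M) [⋀^Fin (d + 2)]→ₗ[ℂ] (A d × M)} (hbr : IsNLieModule (bracketA d) br)
    (hact : ∀ (a : Fin (d + 1) → A d) (m : M), nAction br a m = (0, ι d (basic a) • m))
    (a : Fin (d + 2) → A d) (b : Fin d → A d) (m : M) : generatorQ a b • m = 0 := by
  have h := hbr.isNLieBracket (fun k => (a k, 0))
    (Fin.cons ((0 : A d), m) (fun k => (b k, (0 : M))) : Fin (d + 1) → A d × M)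
  rw [hbr.subalgebra] at h
  have h1 : ∀ u : A d, br (Fin.cons (u, (0 : M)) (Fin.cons ((0 : A d), m)
      (fun k => (b k, (0 : M))) : Fin (d + 1) → A d × M)) =
      (-1 : ℂ) ^ d • ((0 : A d), ι d (basic (Fin.cons u b)) • m) := by
    intro u
    have : (Fin.cons (u, (0 : M)) (Fin.cons ((0 : A d), m)
        (fun k => (b k, (0 : M))) : Fin (d + 1) → A d × M) : Fin (d + 2) → A d × M) =
        Fin.insertNth (α := fun _ => A d × M) (1 : Fin (d + 2)) ((0 : A d), m)
          (fun k => ((Fin.cons u b : Fin (d + 1) → A d) k, (0 : M))) := by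
      refine (Fin.insertNth_eq_iff.2 ⟨by rw [← Fin.succ_zero_eq_one]; rfl, ?_⟩).symm
      funext k
      refine Fin.cases ?_ (fun k => ?_) k
      · rw [Fin.removeNth, ← Fin.succ_zero_eq_one, Fin.succ_succAbove_zero]; rfl
      · rw [Fin.removeNth, ← Fin.succ_zero_eq_one, Fin.succ_succAbove_succ,
          Fin.zero_succAbove]; rfl
    rw [this, br_insertNth hact]
    congr 1
    exact neg_one_pow_eq (by rw [Fin.val_one]; omega)
  rw [h1] at h
  have h2 : ∀ i : Fin (d + 2), br (Function.update (fun k => (a k, (0 : M))) i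
      (br (Fin.cons (a i, (0 : M)) (Fin.cons ((0 : A d), m)
      (fun k => (b k, (0 : M))) : Fin (d + 1) → A d × M)))) =
      (-1 : ℂ) ^ d • ((0 : A d), ((-1 : ℂ) ^ ((i : ℕ) + 1 + (d + 2)) •
        (ι d (basic (fun k => a (i.succAbove k))) * ι d (basic (Fin.cons (a i) b)))) • m) := by
    intro i
    rw [h1, AlternatingMap.map_update_smul, ← Fin.insertNth_removeNth]
    have : i.removeNth (fun k => (a k, (0 : M))) = fun k => (a (i.succAbove k), 0) := rfl
    rw [this, br_insertNth hact, smul_assoc, mul_smul]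
    simp only [Prod.smul_mk, smul_zero]
  rw [Finset.sum_congr rfl fun i _ => h2 i, ← Finset.smul_sum] at h
  -- Both sides carry the sign of the module entry standing in the second slot; multiplying by it
  -- once more cancels it.
  have h3 := congrArg (fun z => ((-1 : ℂ) ^ d • z).2) h
  simp only [smul_smul, neg_one_pow_mul_self, one_smul, Prod.snd_sum] at h3
  rw [generatorQ, sub_smul, Finset.sum_smul, h3, sub_self]

variable [IsScalarTower ℂ (U d) M]

variable (d M) in
/-- `(a, m) ↦ (c ↦ (c₁ ∧ … ∧ cₙ₋₁) • m)`. -/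
noncomputable def moduleSlot : (A d × M) →ₗ[ℂ] (A d × M) [⋀^Fin (d + 1)]→ₗ[ℂ] M where
  toFun p := ((((LinearMap.toSpanSingleton (U d) M p.2).restrictScalars ℂ) ∘ₗ
    (ι d : so d →ₗ[ℂ] U d)).compAlternatingMap (basicAlt d)).compLinearMap
      (LinearMap.fst ℂ (A d) M)
  map_add' p q := by ext c; simp
  map_smul' t p := by
    ext c
    simp only [AlternatingMap.compLinearMap_apply, LinearMap.compAlternatingMap_apply,
      AlternatingMap.smul_apply, LinearMap.comp_apply, LinearMap.restrictScalars_apply,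
      LinearMap.toSpanSingleton_apply, Prod.smul_snd, RingHom.id_apply]
    exact smul_algebra_smul_comm _ _ _

variable (d M) in
/-- The bracket on `A ⊕ M` defined by a module `M` of the enveloping algebra. -/
noncomputable def moduleBracket : (A d × M) [⋀^Fin (d + 2)]→ₗ[ℂ] (A d × M) :=
  ((bracketA d).compLinearMap (LinearMap.fst ℂ (A d) M)).prod
    ((-1 : ℂ) ^ (d + 1) • AlternatingMap.alternatizeUncurryFin (moduleSlot d M))

/-- The bracket is the alternating sum over the slot that supplies the module entry. The
normalization `(-1)^(d+1)` makes the coefficient of the last slot equal to one. -/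
theorem moduleBracket_apply (z : Fin (d + 2) → A d × M) :
    moduleBracket d M z = (bracketA d fun k => (z k).1,
      ∑ i : Fin (d + 2), (-1 : ℂ) ^ ((i : ℕ) + 1 + (d + 2)) •
        ι d (basic fun k => (z (i.succAbove k)).1) • (z i).2) := by
  refine Prod.ext rfl ?_
  change ((-1 : ℂ) ^ (d + 1) • AlternatingMap.alternatizeUncurryFin (moduleSlot d M)) z = _
  rw [AlternatingMap.smul_apply, AlternatingMap.alternatizeUncurryFin_apply, Finset.smul_sum]
  refine Finset.sum_congr rfl fun i _ => ?_
  rw [← Int.cast_smul_eq_zsmul ℂ, smul_smul]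
  push_cast
  rw [← pow_add, neg_one_pow_eq (show (d + 1 + (i : ℕ)) % 2 = ((i : ℕ) + 1 + (d + 2)) % 2 by omega)]
  rfl

theorem nAction_moduleBracket (a : Fin (d + 1) → A d) (m : M) :
    nAction (moduleBracket d M) a m = (0, ι d (basic a) • m) := by
  unfold nAction
  rw [moduleBracket_apply]
  refine Prod.ext ?_ ?_
  · refine (bracketA d).map_coord_zero (Fin.last _) ?_
    rw [Fin.snoc_last]
  · dsimp only
    rw [Fin.sum_univ_castSucc, Finset.sum_eq_zero, zero_add]
    · simp only [Fin.succAbove_last, Fin.snoc_castSucc, Fin.snoc_last]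
      rw [neg_one_pow_eq (l := 0) (by rw [Fin.val_last]; omega), pow_zero, one_smul]
    · intro i _
      rw [Fin.snoc_castSucc, smul_zero, smul_zero]

/-- The `M`-component is linear in the module entries. For an entry `x_k` the identity is a
commutator relation in `so(n+1)`, namely `lie_basic`; for an entry `y_j` it is the vanishing of a
generator of `Q(A)`. -/
theorem isNLieBracket_moduleBracket (hQ : ∀ q ∈ Q d, ∀ m : M, q • m = 0) :
    IsNLieBracket (moduleBracket d M) := by
  intro x y
  have hgen : ∀ (a : Fin (d + 2) → A d) (b : Fin d → A d) (m : M),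
      ι d (basic (Fin.cons (bracketA d a) b)) • m =
        ∑ i : Fin (d + 2), (-1 : ℂ) ^ ((i : ℕ) + 1 + (d + 2)) •
          ι d (basic (fun k => a (i.succAbove k))) • ι d (basic (Fin.cons (a i) b)) • m := by
    intro a b m
    have h := hQ _ (TwoSidedIdeal.subset_span ⟨a, b, rfl⟩) m
    rw [generatorQ, sub_smul, sub_eq_zero, Finset.sum_smul] at h
    rw [h]
    exact Finset.sum_congr rfl fun i _ => by rw [smul_assoc, mul_smul]
  have hcons : ∀ v : A d × M, moduleBracket d M (Fin.cons v y) =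
      (bracketA d (Fin.cons v.1 fun k => (y k).1),
        (-1 : ℂ) ^ (d + 1) • ι d (basic fun k => (y k).1) • v.2 +
        ∑ j : Fin (d + 1), (-1 : ℂ) ^ ((j : ℕ) + d) •
          ι d (basic (Fin.cons v.1 fun k => (y (j.succAbove k)).1)) • (y j).2) := by
    intro v
    rw [moduleBracket_apply]
    refine Prod.ext ?_ ?_
    · dsimp only
      congr 1
      funext k
      refine Fin.cases ?_ (fun k => ?_) k <;> rfl
    · dsimp only
      rw [Fin.sum_univ_succ]
      congr 1
      · rw [neg_one_pow_eq (l := d + 1) (by rw [Fin.val_zero]; omega)]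
        simp only [Fin.zero_succAbove, Fin.cons_succ, Fin.cons_zero]
      · refine Finset.sum_congr rfl fun j _ => ?_
        rw [neg_one_pow_eq (l := (j : ℕ) + d) (by rw [Fin.val_succ]; omega), Fin.cons_succ]
        have : (fun k => ((Fin.cons v y : Fin (d + 2) → A d × M) (j.succ.succAbove k)).1) =
            Fin.cons v.1 fun k => (y (j.succAbove k)).1 := by
          funext k
          refine Fin.cases ?_ (fun k => ?_) k
          · rw [Fin.succ_succAbove_zero]; rfl
          · rw [Fin.succ_succAbove_succ]; rfl
        rw [this]
  have hupd : ∀ v : Fin (d + 2) → A d × M,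
      (∑ i, moduleBracket d M (Function.update x i (v i))).2 =
      ∑ k : Fin (d + 2), (-1 : ℂ) ^ ((k : ℕ) + 1 + (d + 2)) •
        (ι d (basic fun l => (x (k.succAbove l)).1) • (v k).2 +
          ∑ l, ι d (basic (Function.update (fun l => (x (k.succAbove l)).1) l
            (v (k.succAbove l)).1)) • (x k).2) := by
    intro v
    simp only [moduleBracket_apply, Prod.snd_sum]
    rw [Finset.sum_comm]
    refine Finset.sum_congr rfl fun k _ => ?_
    rw [← Finset.smul_sum, Fin.sum_univ_succAbove _ k]
    congr 2
    · rw [Function.update_self]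
      congr 3
      funext l
      rw [Function.update_of_ne (Fin.succAbove_ne k l)]
    · refine Finset.sum_congr rfl fun l _ => ?_
      rw [Function.update_of_ne (Fin.succAbove_ne k l).symm]
      congr 3
      funext l'
      by_cases hl : l' = l
      · subst hl; rw [Function.update_self, Function.update_self]
      · rw [Function.update_of_ne hl, Function.update_of_ne
          (fun h => hl (Fin.succAbove_right_injective h))]
  refine Prod.ext ?_ ?_
  · have h := isNLieBracket_bracketA d (fun i => (x i).1) (fun i => (y i).1)
    rw [hcons, moduleBracket_apply]
    dsimp only
    rw [h, Prod.fst_sum]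
    refine Finset.sum_congr rfl fun i _ => ?_
    rw [hcons, moduleBracket_apply]
    dsimp only
    congr 1
    funext k
    by_cases hk : k = i
    · subst hk; rw [Function.update_self, Function.update_self]
    · rw [Function.update_of_ne hk, Function.update_of_ne hk]
  · rw [hupd fun i => moduleBracket d M (Fin.cons (x i) y), hcons, moduleBracket_apply]
    simp only [hcons]
    set c : Fin (d + 1) → A d := fun k => (y k).1 with hc
    -- Inserting `[x_l, y]` in turn into the slots of the element of `so(n+1)` is its commutator
    -- with `c = y₁ ∧ … ∧ yₙ₋₁`, up to the sign of `bracketA_cons`.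
    have hlie : ∀ k : Fin (d + 2),
        ∑ l, ι d (basic (Function.update (fun l => (x (k.succAbove l)).1) l
            (bracketA d (Fin.cons (x (k.succAbove l)).1 c)))) • (x k).2 =
        (-1 : ℂ) ^ (d + 1) • (ι d (basic c) • ι d (basic fun l => (x (k.succAbove l)).1) • (x k).2 -
          ι d (basic fun l => (x (k.succAbove l)).1) • ι d (basic c) • (x k).2) := by
      intro k
      rw [← Finset.sum_smul]
      simp only [bracketA_cons, ← basicAlt_apply, AlternatingMap.map_update_smul]
      rw [← map_sum, ← Finset.smul_sum]
      simp only [basicAlt_apply]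
      rw [← lie_basic (basic c), map_smul, LieHom.map_lie, Ring.lie_def, smul_assoc, sub_smul,
        mul_smul, mul_smul]
    simp only [hlie, smul_add, smul_sub, Finset.sum_add_distrib, Finset.sum_sub_distrib,
      Finset.smul_sum]
    have hcm : ∀ (u : U d) (t : ℂ) (m : M), u • t • m = t • u • m :=
      fun u t m => smul_algebra_smul_comm t u m
    simp only [hcm]
    have hB : ∀ j : Fin (d + 1), (-1 : ℂ) ^ ((j : ℕ) + d) • ι d (basic (Fin.cons
        ((bracketA d) fun k => (x k).1) fun k => (y (j.succAbove k)).1)) • (y j).2 =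
        ∑ i : Fin (d + 2), (-1 : ℂ) ^ ((i : ℕ) + 1 + (d + 2)) • (-1 : ℂ) ^ ((j : ℕ) + d) •
          ι d (basic fun l => (x (i.succAbove l)).1) •
            ι d (basic (Fin.cons (x i).1 fun k => (y (j.succAbove k)).1)) • (y j).2 := by
      intro j
      rw [hgen, Finset.smul_sum]
      exact Finset.sum_congr rfl fun i _ => smul_comm _ _ _
    have hA : ∀ i : Fin (d + 2), (-1 : ℂ) ^ (d + 1) • (-1 : ℂ) ^ ((i : ℕ) + 1 + (d + 2)) •
        ι d (basic c) • ι d (basic fun k => (x (i.succAbove k)).1) • (x i).2 =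
        (-1 : ℂ) ^ ((i : ℕ) + 1 + (d + 2)) • (-1 : ℂ) ^ (d + 1) •
        ι d (basic c) • ι d (basic fun k => (x (i.succAbove k)).1) • (x i).2 :=
      fun i => smul_comm _ _ _
    rw [Finset.sum_congr rfl fun i _ => hA i, Finset.sum_congr rfl fun j _ => hB j,
      Finset.sum_comm]
    abel

theorem isIrreducibleNLieModule_moduleBracket (hQ : ∀ q ∈ Q d, ∀ m : M, q • m = 0)
    [IsSimpleModule (U d) M] : IsIrreducibleNLieModule (bracketA d) (moduleBracket d M) := by
  refine ⟨⟨isNLieBracket_moduleBracket hQ, ?_, ?_, ?_⟩, IsSimpleModule.nontrivial (U d) M, ?_⟩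
  · intro x
    rw [moduleBracket_apply]
    refine Prod.ext rfl ?_
    dsimp only
    exact Finset.sum_eq_zero fun i _ => by rw [smul_zero, smul_zero]
  · intro z k hk
    rw [moduleBracket_apply]
    exact (bracketA d).map_coord_zero k hk
  · intro z j k hjk hj hk
    rw [moduleBracket_apply]
    refine Prod.ext ((bracketA d).map_coord_zero k hk) ?_
    dsimp only [Prod.snd_zero]
    refine Finset.sum_eq_zero fun i _ => ?_
    -- Removing slot `i` leaves at least one of the two entries lying in `M`, which kills the
    -- element of `so(n+1)`.
    have : ∃ l, (z (i.succAbove l)).1 = 0 := by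
      by_cases hi : j = i
      · obtain ⟨l, hl⟩ := Fin.exists_succAbove_eq (x := k) (y := i) (hi ▸ hjk.symm)
        exact ⟨l, by rw [hl, hk]⟩
      · obtain ⟨l, hl⟩ := Fin.exists_succAbove_eq hi
        exact ⟨l, by rw [hl, hj]⟩
    obtain ⟨l, hl⟩ := this
    rw [← basicAlt_apply, (basicAlt d).map_coord_zero l hl, map_zero, zero_smul, smul_zero]
  · intro W hW
    simp only [nAction_moduleBracket] at hW
    have hX : ∀ X : so d, ∀ m ∈ W, ι d X • m ∈ W := by
      intro X
      refine Submodule.span_induction (p := fun X _ => ∀ m ∈ W, ι d X • m ∈ W) ?_ ?_ ?_ ?_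
        (mem_span_basic X)
      · rintro _ ⟨a, rfl⟩ m hm
        exact hW a m hm
      · intro m _
        rw [map_zero, zero_smul]; exact W.zero_mem
      · intro X Y _ _ hX hY m hm
        rw [map_add, add_smul]; exact W.add_mem (hX m hm) (hY m hm)
      · intro t X _ hX m hm
        rw [map_smul, smul_assoc]; exact W.smul_mem t (hX m hm)
    have hU : ∀ u : U d, ∀ m ∈ W, u • m ∈ W := by
      intro u m hm
      let T : Submodule ℂ (U d) :=
        W.comap ((LinearMap.toSpanSingleton (U d) M m).restrictScalars ℂ)
      refine mem_of_ι_mul_mem T ?_ ?_ u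
      · change (1 : U d) • m ∈ W
        rwa [one_smul]
      · intro X t ht
        change (ι d X * t) • m ∈ W
        rw [mul_smul]
        exact hX X _ ht
    let W' : Submodule (U d) M := { W with smul_mem' := fun u m hm => hU u m hm }
    rcases eq_bot_or_eq_top W' with h | h
    · left
      ext m
      exact SetLike.ext_iff.1 h m
    · right
      ext m
      exact SetLike.ext_iff.1 h m

theorem isSimpleModule_of_isIrreducible {br : (A d × M) [⋀^Fin (d + 2)]→ₗ[ℂ] (A d × M)}
    (hbr : IsIrreducibleNLieModule (bracketA d) br)
    (hact : ∀ (a : Fin (d + 1) → A d) (m : M), nAction br a m = (0, ι d (basic a) • m)) :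
    IsSimpleModule (U d) M := by
  have := hbr.2.1
  refine (isSimpleModule_iff _ _).2 { eq_bot_or_eq_top := fun W => ?_ }
  rcases hbr.2.2 (W.restrictScalars ℂ) fun a m hm => by
    rw [hact]; exact W.smul_mem _ hm with h | h
  · exact .inl ((Submodule.restrictScalars_eq_bot_iff ℂ (U d) M).1 h)
  · exact .inr ((Submodule.restrictScalars_eq_top_iff ℂ (U d) M).1 h)

end Module

theorem isIrreducibleAModule_iff {d : ℕ} (lam : Module.Dual ℂ (H d)) :
    IsIrreducibleAModule lam ↔ IsSimpleModule (U d) (Z lam) ∧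
        ∀ q ∈ Q d, ∀ m : Z lam, q • m = 0 := by
  constructor
  · rintro ⟨br, hbr, hact⟩
    exact ⟨isSimpleModule_of_isIrreducible hbr hact,
      smul_eq_zero_of_mem_Q fun a b m => generatorQ_smul_eq_zero hbr.1 hact a b m⟩
  · rintro ⟨h, hQ⟩
    exact ⟨moduleBracket d (Z lam), isIrreducibleNLieModule_moduleBracket hQ,
      nAction_moduleBracket⟩

/-! ### The Pfaffians in `Q(A)` -/

/-- The two indices and the first argument are three rows of one determinant. Together with
`basicEntry_swap_left` this gives total antisymmetry in `p, q, s`. -/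
theorem basicEntry_swap {d : ℕ} (p q s : Fin (d + 3)) (b : Fin d → A d) :
    basicEntry p q (Fin.cons (e s) b) = -basicEntry p s (Fin.cons (e q) b) := by
  have h := (Matrix.detRowAlternating (n := Fin (d + 3)) (R := ℂ)).map_swap
    (Fin.cons (e p) (Fin.cons (e q) (Fin.cons (e s) b : Fin (d + 1) → A d) : Fin (d + 2) → A d) :
      Fin (d + 3) → A d) (i := Fin.succ 0) (j := Fin.succ (Fin.succ 0))
      (fun h => Fin.succ_ne_zero _ (Fin.succ_injective _ h.symm))
  have h2 : (Fin.cons (e p) (Fin.cons (e q) (Fin.cons (e s) b : Fin (d + 1) → A d) :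
      Fin (d + 2) → A d) : Fin (d + 3) → A d) ∘ Equiv.swap (Fin.succ 0) (Fin.succ (Fin.succ 0)) =
      (Fin.cons (e p) (Fin.cons (e s) (Fin.cons (e q) b : Fin (d + 1) → A d) :
      Fin (d + 2) → A d) : Fin (d + 3) → A d) := by
    funext k
    rw [Function.comp_apply]
    refine Fin.cases ?_ (fun k => ?_) k
    · rw [Equiv.swap_apply_of_ne_of_ne (Fin.succ_ne_zero _).symm (Fin.succ_ne_zero _).symm]; rfl
    · refine Fin.cases ?_ (fun k => ?_) k
      · rw [Equiv.swap_apply_left]; rfl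
      · refine Fin.cases ?_ (fun k => ?_) k
        · rw [Equiv.swap_apply_right]; rfl
        · rw [Equiv.swap_apply_of_ne_of_ne]
          · rfl
          · exact fun h => Fin.succ_ne_zero _ (Fin.succ_injective _ h)
          · exact fun h => Fin.succ_ne_zero _ (Fin.succ_injective _ (Fin.succ_injective _ h))
  rw [h2] at h
  rw [basicEntry_apply, basicEntry_apply, neg_neg]
  exact h.symm

theorem basicEntry_swap_left {d : ℕ} (p q : Fin (d + 3)) (c : Fin (d + 1) → A d) :
    basicEntry p q c = -basicEntry q p c := by
  rw [← basic_apply, ← basic_apply, so_apply_swap]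

theorem basicEntry_self {d : ℕ} (p : Fin (d + 3)) (c : Fin (d + 1) → A d) :
    basicEntry p p c = 0 := by
  linear_combination (basicEntry_swap_left p p c) / 2

theorem det_e_comp_ne_zero {d : ℕ} {g : Fin (d + 3) → Fin (d + 3)} (hg : Function.Injective g) :
    Matrix.det (Matrix.of fun k => (e (g k) : A d)) ≠ 0 := by
  let σ : Equiv.Perm (Fin (d + 3)) := Equiv.ofBijective g (Finite.injective_iff_bijective.1 hg)
  have : (Matrix.of fun k => (e (g k) : A d)) =
      (1 : Matrix (Fin (d + 3)) (Fin (d + 3)) ℂ).submatrix σ id := by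
    ext k l
    simp [e, σ, Matrix.one_apply, Pi.single_apply, eq_comm]
  rw [this, Matrix.det_permute, Matrix.det_one, mul_one]
  exact_mod_cast (Equiv.Perm.sign σ).ne_zero

theorem basicEntry_eq_zero {d : ℕ} {τ : Fin d → Fin (d + 3)} {p q s : Fin (d + 3)}
    (h : s ∈ Set.range τ) : basicEntry p q (Fin.cons (e s) fun k => e (τ k)) = 0 := by
  obtain ⟨k, rfl⟩ := h
  exact (basicEntry p q).map_eq_zero_of_eq _ (i := 0) (j := k.succ) rfl (Fin.succ_ne_zero k).symm

/-- When `τ` lists the complement of `{i, j, k}`, a row or column index outside `{j, k}` repeats a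
row of the determinant, so only the plane of `e_j, e_k` survives. -/
theorem basic_cons_e {d : ℕ} {τ : Fin d → Fin (d + 3)} {i j k : Fin (d + 3)} (hij : i ≠ j)
    (hik : i ≠ k) (hjk : j ≠ k) (hτ : ∀ s, s ∈ Set.range τ ↔ s ≠ i ∧ s ≠ j ∧ s ≠ k) :
    basic (Fin.cons (e i) fun k => e (τ k)) =
      basicEntry j k (Fin.cons (e i) fun k => e (τ k)) • wedge (e j) (e k) := by
  have hz : ∀ p q, (p = i ∨ p ∈ Set.range τ) →
      basicEntry p q (Fin.cons (e i) fun k => e (τ k)) = 0 := by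
    intro p q h
    rw [basicEntry_swap_left, neg_eq_zero]
    rcases h with rfl | h
    · have := basicEntry_swap q p p (fun k => e (τ k))
      linear_combination this / 2
    · rw [basicEntry_swap, basicEntry_eq_zero h, neg_zero]
  have hz' : ∀ p q, (q = i ∨ q ∈ Set.range τ) →
      basicEntry p q (Fin.cons (e i) fun k => e (τ k)) = 0 := by
    intro p q h
    rw [basicEntry_swap_left, hz q p h, neg_zero]
  ext p q
  rw [basic_apply, SetLike.val_smul, Matrix.smul_apply, wedge_apply]
  have he : ∀ a b : Fin (d + 3), (e a : A d) b = if b = a then 1 else 0 := fun a b => by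
    simp [e, Pi.single_apply]
  simp only [he, smul_eq_mul]
  have hcase : ∀ s, s = j ∨ s = k ∨ ((s = i ∨ s ∈ Set.range τ) ∧ s ≠ j ∧ s ≠ k) := by
    intro s
    rw [hτ]
    by_cases h1 : s = j
    · exact .inl h1
    by_cases h2 : s = k
    · exact .inr (.inl h2)
    by_cases h3 : s = i
    · exact .inr (.inr ⟨.inl h3, h1, h2⟩)
    · exact .inr (.inr ⟨.inr ⟨h3, h1, h2⟩, h1, h2⟩)
  rcases hcase p with rfl | rfl | ⟨hp, hp1, hp2⟩
  · rcases hcase q with rfl | rfl | ⟨hq, hq1, hq2⟩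
    · rw [basicEntry_self]; simp
    · simp [hjk, hjk.symm]
    · rw [hz' _ _ hq]; simp [hq1, hq2]
  · rcases hcase q with rfl | rfl | ⟨hq, hq1, hq2⟩
    · rw [basicEntry_swap_left]; simp [hjk, hjk.symm]
    · rw [basicEntry_self]; simp
    · rw [hz' _ _ hq]; simp [hq1, hq2]
  · rw [hz _ _ hp]; simp [hp1, hp2]

/-- Take `[a₁,…,aₙ] = e_r` and let `b` list all basis vectors except `e_i, e_j, e_k`. In
`generatorQ_eq` only `s = i, j, k` contribute, and the linear term drops out because `e_r` already
occurs in `b`. -/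
theorem pfaffian_mem_Q {d : ℕ} {r i j k : Fin (d + 3)} (hri : r ≠ i) (hrj : r ≠ j) (hrk : r ≠ k)
    (hij : i ≠ j) (hik : i ≠ k) (hjk : j ≠ k) :
    ι d (wedge (e r) (e i)) * ι d (wedge (e j) (e k)) -
      ι d (wedge (e r) (e j)) * ι d (wedge (e i) (e k)) +
      ι d (wedge (e r) (e k)) * ι d (wedge (e i) (e j)) ∈ Q d := by
  have hcard : (({i, j, k} : Finset (Fin (d + 3)))ᶜ).card = d := by
    rw [Finset.card_compl, Finset.card_eq_three.2 ⟨i, j, k, hij, hik, hjk, rfl⟩, Fintype.card_fin]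
    rfl
  let τ := ({i, j, k} : Finset (Fin (d + 3)))ᶜ.orderEmbOfFin hcard
  have hτ : Set.range τ = ((({i, j, k} : Finset (Fin (d + 3)))ᶜ : Finset _) : Set (Fin (d + 3))) :=
    Finset.range_orderEmbOfFin _ _
  have hmem : ∀ s, s ∈ Set.range τ ↔ s ≠ i ∧ s ≠ j ∧ s ≠ k := by
    intro s
    rw [hτ]; simp; tauto
  obtain ⟨a, ha⟩ := exists_bracketA_eq r
  set b : Fin d → A d := fun l => e (τ l) with hb
  set B := basicEntry j k (Fin.cons (e i) b) with hB
  -- Up to sign, `B` is the determinant of a permutation matrix.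
  have hB0 : B ≠ 0 := by
    rw [hB, basicEntry_apply, neg_ne_zero]
    have hinj : Function.Injective (Fin.cons j (Fin.cons k (Fin.cons i τ : Fin (d + 1) → _) :
        Fin (d + 2) → _) : Fin (d + 3) → Fin (d + 3)) := by
      simp only [Fin.cons_injective_iff]
      refine ⟨?_, ?_, ?_, τ.injective⟩
      · simp only [Fin.range_cons, Set.mem_insert_iff, hmem]
        tauto
      · simp only [Fin.range_cons, Set.mem_insert_iff, hmem]
        tauto
      · rw [hmem]; tauto
    convert det_e_comp_ne_zero hinj using 2
    refine congrArg Matrix.of (funext fun l => ?_)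
    refine Fin.cases ?_ (fun l => ?_) l
    · rfl
    · refine Fin.cases ?_ (fun l => ?_) l
      · rfl
      · refine Fin.cases ?_ (fun l => ?_) l <;> rfl
  have hi : basicTail b (e i) = B • ι d (wedge (e j) (e k)) := by
    rw [basicTail_apply, basic_cons_e hij hik hjk hmem, map_smul]
  have hj : basicTail b (e j) = -B • ι d (wedge (e i) (e k)) := by
    rw [basicTail_apply, basic_cons_e hij.symm hjk hik fun s => by rw [hmem]; tauto, map_smul,
      basicEntry_swap_left, basicEntry_swap, basicEntry_swap_left, neg_neg]
  have hk : basicTail b (e k) = B • ι d (wedge (e i) (e j)) := by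
    rw [basicTail_apply, basic_cons_e hik.symm hjk.symm hij fun s => by rw [hmem]; tauto, map_smul,
      basicEntry_swap_left, basicEntry_swap, neg_neg]
  have h0 : ∀ s ∈ Finset.univ, s ∉ ({i, j, k} : Finset (Fin (d + 3))) →
      ι d (wedge (e r) (e s)) * basicTail b (e s) = 0 := by
    intro s _ hs
    have hs : s ∈ Set.range τ := by
      rw [hmem]; simpa using hs
    have : basic (Fin.cons (e s) b) = 0 := by
      ext p q
      rw [basic_apply, basicEntry_eq_zero hs]; rfl
    rw [basicTail_apply, this, map_zero, mul_zero]
  have hr0 : basicTail b (e r) = 0 := by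
    have : basic (Fin.cons (e r) b) = 0 := by
      ext p q
      rw [basic_apply, basicEntry_eq_zero ((hmem r).2 ⟨hri, hrj, hrk⟩)]; rfl
    rw [basicTail_apply, this, map_zero]
  have hg : generatorQ a b = -(B • (ι d (wedge (e r) (e i)) * ι d (wedge (e j) (e k)) -
      ι d (wedge (e r) (e j)) * ι d (wedge (e i) (e k)) +
      ι d (wedge (e r) (e k)) * ι d (wedge (e i) (e j)))) := by
    rw [generatorQ_eq, ha, hr0, zero_sub, Finset.sum_eq_single r]
    · rw [Finset.sum_congr rfl fun s _ => by
        rw [show (e r : A d) r = 1 by simp [e], one_smul],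
        ← Finset.sum_subset (Finset.subset_univ _) h0, Finset.sum_insert (by simp [hij, hik]),
        Finset.sum_insert (by simp [hjk]), Finset.sum_singleton, hi, hj, hk]
      simp only [mul_smul_comm]
      module
    · intro r' _ hr'
      refine Finset.sum_eq_zero fun s _ => ?_
      rw [show (e r : A d) r' = 0 by simp [e, hr'], zero_smul]
    · simp
  have hQ : generatorQ a b ∈ Q d := TwoSidedIdeal.subset_span ⟨a, b, rfl⟩
  have := (Q d).mul_mem_left (algebraMap ℂ (U d) (-B⁻¹)) _ hQ
  rwa [hg, ← Algebra.smul_def, smul_neg, neg_smul, neg_neg, smul_smul, inv_mul_cancel₀ hB0,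
    one_smul] at this

/-! ### The isotropic basis and the root vectors -/

section Vectors

variable {d : ℕ}

theorem inv_sqrt_two_sq : (((Real.sqrt 2 : ℝ) : ℂ)⁻¹) * ((Real.sqrt 2 : ℝ) : ℂ)⁻¹ = 2⁻¹ := by
  rw [← mul_inv, ← Complex.ofReal_mul, Real.mul_self_sqrt (by norm_num)]
  norm_num

theorem e_dotProduct (i : Fin (d + 3)) (v : A d) : e i ⬝ᵥ v = v i := by simp [e]

theorem eOdd_dot_eOdd (j k : Fin (rk d)) : (eOdd j : A d) ⬝ᵥ eOdd k = if j = k then 1 else 0 := by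
  rw [eOdd, e_dotProduct]
  simp only [eOdd, e, Pi.single_apply, Fin.ext_iff]
  congr 1
  simp

theorem eEven_dot_eEven (j k : Fin (rk d)) :
    (eEven j : A d) ⬝ᵥ eEven k = if j = k then 1 else 0 := by
  rw [eEven, e_dotProduct]
  simp only [eEven, e, Pi.single_apply, Fin.ext_iff]
  congr 1
  simp

theorem eOdd_dot_eEven (j k : Fin (rk d)) : (eOdd j : A d) ⬝ᵥ eEven k = 0 := by
  rw [eOdd, e_dotProduct]
  simp only [eEven, e, Pi.single_apply, Fin.ext_iff]
  rw [if_neg (by omega)]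

theorem eEven_dot_eOdd (j k : Fin (rk d)) : (eEven j : A d) ⬝ᵥ eOdd k = 0 := by
  rw [dotProduct_comm, eOdd_dot_eEven]

theorem vPos_dot_vPos (j k : Fin (rk d)) : (vPos j : A d) ⬝ᵥ vPos k = 0 := by
  simp only [vPos, smul_dotProduct, dotProduct_smul, sub_dotProduct, dotProduct_sub,
    eOdd_dot_eOdd, eEven_dot_eEven, eOdd_dot_eEven, eEven_dot_eOdd, smul_eq_mul]
  split_ifs
  · linear_combination
      (((Real.sqrt 2 : ℝ) : ℂ)⁻¹) * ((Real.sqrt 2 : ℝ) : ℂ)⁻¹ * Complex.I_mul_I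
  · ring

theorem vNeg_dot_vNeg (j k : Fin (rk d)) : (vNeg j : A d) ⬝ᵥ vNeg k = 0 := by
  simp only [vNeg, smul_dotProduct, dotProduct_smul, add_dotProduct, dotProduct_add,
    eOdd_dot_eOdd, eEven_dot_eEven, eOdd_dot_eEven, eEven_dot_eOdd, smul_eq_mul]
  split_ifs
  · linear_combination
      (((Real.sqrt 2 : ℝ) : ℂ)⁻¹) * ((Real.sqrt 2 : ℝ) : ℂ)⁻¹ * Complex.I_mul_I
  · ring

theorem vPos_dot_vNeg (j k : Fin (rk d)) :
    (vPos j : A d) ⬝ᵥ vNeg k = if j = k then 1 else 0 := by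
  simp only [vNeg, vPos, smul_dotProduct, dotProduct_smul, sub_dotProduct, dotProduct_add,
    eOdd_dot_eOdd, eEven_dot_eEven, eOdd_dot_eEven, eEven_dot_eOdd, smul_eq_mul]
  split_ifs
  · linear_combination 2 * inv_sqrt_two_sq -
      (((Real.sqrt 2 : ℝ) : ℂ)⁻¹) * ((Real.sqrt 2 : ℝ) : ℂ)⁻¹ * Complex.I_mul_I
  · ring

theorem vNeg_dot_vPos (j k : Fin (rk d)) :
    (vNeg j : A d) ⬝ᵥ vPos k = if j = k then 1 else 0 := by
  rw [dotProduct_comm, vPos_dot_vNeg]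
  simp only [eq_comm]

theorem eOdd_eq (j : Fin (rk d)) :
    (eOdd j : A d) = ((Real.sqrt 2 : ℝ) : ℂ)⁻¹ • (vPos j + vNeg j) := by
  rw [vPos, vNeg, ← smul_add, smul_smul, inv_sqrt_two_sq]
  module

theorem eEven_eq (j : Fin (rk d)) :
    (eEven j : A d) = (Complex.I * ((Real.sqrt 2 : ℝ) : ℂ)⁻¹) • (vPos j - vNeg j) := by
  rw [vPos, vNeg, ← smul_sub, smul_smul, mul_assoc, inv_sqrt_two_sq]
  have : (eOdd j - Complex.I • eEven j : A d) - (eOdd j + Complex.I • eEven j) =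
      (-2 * Complex.I) • eEven j := by module
  rw [this, smul_smul]
  have : Complex.I * 2⁻¹ * (-2 * Complex.I) = 1 := by linear_combination -Complex.I_mul_I
  rw [this, one_smul]

theorem wedge_add_left (u u' w : A d) : wedge (u + u') w = wedge u w + wedge u' w := by
  simp only [← wedgeBilin_apply, map_add, LinearMap.add_apply]

theorem wedge_add_right (u w w' : A d) : wedge u (w + w') = wedge u w + wedge u w' := by
  simp only [← wedgeBilin_apply, map_add]

theorem wedge_sub_left (u u' w : A d) : wedge (u - u') w = wedge u w - wedge u' w := by
  simp only [← wedgeBilin_apply, map_sub, LinearMap.sub_apply]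

theorem wedge_sub_right (u w w' : A d) : wedge u (w - w') = wedge u w - wedge u w' := by
  simp only [← wedgeBilin_apply, map_sub]

theorem wedge_smul_left (c : ℂ) (u w : A d) : wedge (c • u) w = c • wedge u w := by
  simp only [← wedgeBilin_apply, map_smul, LinearMap.smul_apply]

theorem wedge_smul_right (c : ℂ) (u w : A d) : wedge u (c • w) = c • wedge u w := by
  simp only [← wedgeBilin_apply, map_smul]

theorem wedge_vPos_vNeg (j : Fin (rk d)) : wedge (vPos j : A d) (vNeg j) = eps j := by
  rw [eps, vPos, vNeg]
  rw [wedge_smul_left, wedge_smul_right, smul_smul, inv_sqrt_two_sq]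
  simp only [wedge_smul_left, wedge_smul_right, wedge_sub_left, wedge_add_right, wedge_self]
  rw [wedge_swap (eOdd j) (eEven j)]
  module

theorem wedge_eOdd_eEven (j : Fin (rk d)) :
    wedge (eOdd j : A d) (eEven j) = -Complex.I • eps j := by
  rw [eps, smul_smul]
  simp

theorem lie_pos_pos_neg_neg {j k : Fin (rk d)} (h : j ≠ k) :
    ⁅wedge (vPos j : A d) (vPos k), wedge (vNeg j : A d) (vNeg k)⁆ = -(eps j + eps k) := by
  rw [lie_wedge, wedge_mulVec, wedge_mulVec]
  simp only [vPos_dot_vNeg, if_neg h, if_neg h.symm, if_true, zero_smul, one_smul, zero_sub,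
    sub_zero]
  -- Negatives are written as differences from zero, and zero as a multiple of itself, so that the
  -- linearity lemmas for `wedge` apply.
  rw [wedge_swap (vPos j) (vNeg j), ← zero_sub (vPos k : A d), wedge_sub_left,
    ← wedge_vPos_vNeg, ← wedge_vPos_vNeg, ← zero_smul ℂ (0 : A d), wedge_smul_left]
  module

theorem lie_pos_neg_neg_pos (j k : Fin (rk d)) :
    ⁅wedge (vPos j : A d) (vNeg k), wedge (vNeg j : A d) (vPos k)⁆ = eps k - eps j := by
  rw [lie_wedge, wedge_mulVec, wedge_mulVec]
  simp only [vPos_dot_vNeg, vPos_dot_vPos, vNeg_dot_vPos, vNeg_dot_vNeg,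
    if_true, zero_smul, one_smul, zero_sub, sub_zero]
  rw [wedge_swap (vPos j) (vNeg j), ← zero_sub (vNeg k : A d), wedge_sub_left,
    wedge_swap (vPos k) (vNeg k),
    ← wedge_vPos_vNeg, ← wedge_vPos_vNeg, ← zero_smul ℂ (0 : A d), wedge_smul_left]
  module

theorem lie_neg_pos_neg_neg {j k : Fin (rk d)} (h : j ≠ k) :
    ⁅wedge (vNeg j : A d) (vPos k), wedge (vNeg j : A d) (vNeg k)⁆ = 0 := by
  rw [lie_wedge, wedge_mulVec, wedge_mulVec]
  simp only [vPos_dot_vNeg, vNeg_dot_vNeg, if_neg h.symm,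
    if_true, zero_smul, one_smul, sub_zero, wedge_self]
  rw [← zero_smul ℂ (0 : A d), wedge_smul_left, zero_smul, zero_add]

theorem wedge_eOdd_eOdd (j k : Fin (rk d)) :
    wedge (eOdd j : A d) (eOdd k) = (2 : ℂ)⁻¹ • (wedge (vPos j) (vPos k) +
      wedge (vPos j) (vNeg k) + wedge (vNeg j) (vPos k) + wedge (vNeg j) (vNeg k)) := by
  rw [eOdd_eq, eOdd_eq, wedge_smul_left, wedge_smul_right, smul_smul, inv_sqrt_two_sq]
  simp only [wedge_add_left, wedge_add_right]
  module

theorem wedge_eEven_eEven (j k : Fin (rk d)) :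
    wedge (eEven j : A d) (eEven k) = (2 : ℂ)⁻¹ • (-wedge (vPos j) (vPos k) +
      wedge (vPos j) (vNeg k) + wedge (vNeg j) (vPos k) - wedge (vNeg j) (vNeg k)) := by
  rw [eEven_eq, eEven_eq, wedge_smul_left, wedge_smul_right, smul_smul, mul_mul_mul_comm,
    inv_sqrt_two_sq, Complex.I_mul_I]
  simp only [wedge_sub_left, wedge_sub_right]
  module

theorem wedge_eOdd_eEven_eq (j k : Fin (rk d)) :
    wedge (eOdd j : A d) (eEven k) = (Complex.I * 2⁻¹) • (wedge (vPos j) (vPos k) -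
      wedge (vPos j) (vNeg k) + wedge (vNeg j) (vPos k) - wedge (vNeg j) (vNeg k)) := by
  rw [eOdd_eq, eEven_eq, wedge_smul_left, wedge_smul_right, smul_smul, mul_left_comm,
    inv_sqrt_two_sq]
  simp only [wedge_add_left, wedge_sub_right]
  module

theorem wedge_eEven_eOdd_eq (j k : Fin (rk d)) :
    wedge (eEven j : A d) (eOdd k) = (Complex.I * 2⁻¹) • (wedge (vPos j) (vPos k) +
      wedge (vPos j) (vNeg k) - wedge (vNeg j) (vPos k) - wedge (vNeg j) (vNeg k)) := by
  rw [eOdd_eq, eEven_eq, wedge_smul_left, wedge_smul_right, smul_smul, mul_assoc,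
    inv_sqrt_two_sq]
  simp only [wedge_sub_left, wedge_add_right]
  module

end Vectors

/-! ### The Pfaffians on a highest weight vector -/

/-- In isotropic vectors the Cartan part of the Pfaffian gives `-xy`. In the remaining products the
raising operators are moved to the right, where they kill `v`; the commutators `-(ε_j + ε_k)` and
`ε_k - ε_j` left behind contribute `-y`. -/
theorem pfaffian_smul_of_highestWeight {d : ℕ} {M : Type*} [AddCommGroup M] [Module ℂ M]
    [Module (U d) M] [IsScalarTower ℂ (U d) M] {j k : Fin (rk d)} (h : j ≠ k) {v : M} {x y : ℂ}
    (hx : ι d (eps j) • v = x • v) (hy : ι d (eps k) • v = y • v)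
    (ha : ι d (wedge (vPos j) (vPos k)) • v = 0) (hb : ι d (wedge (vPos j) (vNeg k)) • v = 0) :
    (ι d (wedge (eOdd j) (eEven j)) * ι d (wedge (eOdd k) (eEven k)) -
      ι d (wedge (eOdd j) (eOdd k)) * ι d (wedge (eEven j) (eEven k)) +
      ι d (wedge (eOdd j) (eEven k)) * ι d (wedge (eEven j) (eOdd k))) • v =
      -(y * (x + 1)) • v := by
  have h1 := congrArg (ι d) (lie_pos_pos_neg_neg h)
  have h2 := congrArg (ι d) (lie_pos_neg_neg_pos j k)
  have h3 := congrArg (ι d) (lie_neg_pos_neg_neg h)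
  rw [LieHom.map_lie, Ring.lie_def, map_neg, map_add] at h1
  rw [LieHom.map_lie, Ring.lie_def, map_sub] at h2
  rw [LieHom.map_lie, Ring.lie_def, map_zero] at h3
  rw [wedge_eOdd_eEven, wedge_eOdd_eEven, wedge_eOdd_eOdd, wedge_eEven_eEven,
    wedge_eOdd_eEven_eq, wedge_eEven_eOdd_eq]
  simp only [map_smul, map_add, map_sub, map_neg]
  rw [smul_mul_smul_comm, smul_mul_smul_comm, smul_mul_smul_comm, mul_mul_mul_comm, neg_mul_neg,
    Complex.I_mul_I]
  set a := ι d (wedge (vPos j) (vPos k))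
  set b := ι d (wedge (vPos j) (vNeg k))
  set c := ι d (wedge (vNeg j) (vPos k))
  set f := ι d (wedge (vNeg j) (vNeg k))
  set X := ι d (eps j)
  set Y := ι d (eps k)
  have hcm : ∀ (u : U d) (t : ℂ) (m : M), u • t • m = t • u • m :=
    fun u t m => smul_algebra_smul_comm t u m
  have h1' := congrArg (fun u => u • v) h1
  have h2' := congrArg (fun u => u • v) h2
  have h3' := congrArg (fun u => u • v) h3
  simp only [sub_smul, add_smul, neg_smul, mul_smul, ha, hb, smul_zero, zero_smul, hx, hy]
    at h1' h2' h3'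
  simp only [add_smul, sub_smul, neg_smul, mul_smul, smul_assoc, smul_add, smul_sub, hcm, ha, hb,
    hx, hy, smul_zero, neg_zero]
  clear_value a b c f
  generalize a • c • v = ac, a • f • v = af, b • c • v = bc, b • f • v = bf, c • c • v = cc,
    c • f • v = cf, f • c • v = fc, f • f • v = ff at *
  -- The first two relations are the commutators just mentioned; the third lets the two lowering
  -- operators commute, so that their products cancel.
  linear_combination (norm := module) (2 : ℂ)⁻¹ • h1' - (2 : ℂ)⁻¹ • h2' + (2 : ℂ)⁻¹ • h3'

/-! ### Necessity of the weight condition -/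

theorem le_J_of_ne_top {d : ℕ} {lam : Module.Dual ℂ (H d)} {K : Ideal (U d)} (hI : I lam ≤ K)
    (hK : K ≠ ⊤) : K ≤ J lam := le_sSup ⟨hI, hK⟩

/-- For a general `λ` the properness of `I(λ)` is not available, so this degenerate case is excluded
directly. If `I(λ) = U`, then `J(λ)` is the supremum of the empty set, so `Z(λ) = U`. Simplicity
would force the augmentation ideal to be zero, against the faithful action of `so(n+1)` on `A`. -/
theorem not_isSimpleModule_of_I_eq_top {d : ℕ} {lam : Module.Dual ℂ (H d)} (hI : I lam = ⊤) :
    ¬ IsSimpleModule (U d) (Z lam) := by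
  intro hs
  have hJ : J lam = ⊥ := by
    refine sSup_eq_bot.2 fun K hK => ?_
    exact absurd (top_le_iff.1 (hI ▸ hK.1)) hK.2
  rw [isSimpleModule_iff_isCoatom, hJ] at hs
  let aug : U d →ₐ[ℂ] ℂ := UniversalEnvelopingAlgebra.lift ℂ (0 : so d →ₗ⁅ℂ⁆ ℂ)
  have hne : RingHom.ker aug.toRingHom ≠ ⊤ := RingHom.ker_ne_top _
  have hker : RingHom.ker aug.toRingHom = ⊥ := (hs.le_iff.1 bot_le).resolve_left hne
  have hι : ∀ X, ι d X = 0 := by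
    intro X
    have : ι d X ∈ RingHom.ker aug.toRingHom := by
      rw [RingHom.mem_ker]
      exact UniversalEnvelopingAlgebra.lift_ι_apply ℂ (0 : so d →ₗ⁅ℂ⁆ ℂ) X
    rwa [hker] at this
  have h2 := UniversalEnvelopingAlgebra.lift_ι_apply ℂ (so d).incl (wedge (e 0) (e 1))
  have h3 : ι d (wedge (e 0) (e 1)) = 0 := hι _
  rw [h3, map_zero] at h2
  have h4 := congrFun (congrFun h2 0) 1
  change (0 : ℂ) = (wedge (e 0) (e 1) : so d).1 0 1 at h4
  rw [wedge_apply] at h4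
  simp [e] at h4

theorem weight_condition_of_Q_smul {d : ℕ} {lam : Module.Dual ℂ (H d)}
    [hs : IsSimpleModule (U d) (Z lam)] (hQ : ∀ q ∈ Q d, ∀ m : Z lam, q • m = 0)
    (j k : Fin (rk d)) (hjk : j < k) : lam (epsH k) * (lam (epsH j) + 1) = 0 := by
  have hI : I lam ≠ ⊤ := fun h => not_isSimpleModule_of_I_eq_top h hs
  have hIJ : I lam ≤ J lam := le_J_of_ne_top le_rfl hI
  -- The highest weight vector, on which the Pfaffians are evaluated.
  let v : Z lam := Submodule.Quotient.mk 1
  have hv : v ≠ 0 := by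
    intro h
    have h1 : (1 : U d) ∈ J lam := (Submodule.Quotient.mk_eq_zero _).1 h
    have hJ : J lam = ⊤ := (Ideal.eq_top_iff_one _).2 h1
    have := IsSimpleModule.nontrivial (U d) (Z lam)
    exact not_subsingleton (Z lam) (Submodule.Quotient.subsingleton_iff.2 hJ)
  have hI0 : ∀ u ∈ I lam, u • v = 0 := by
    intro u hu
    change Submodule.Quotient.mk (u • 1) = _
    rw [smul_eq_mul, mul_one]
    exact (Submodule.Quotient.mk_eq_zero _).2 (hIJ hu)
  have heps : ∀ j : Fin (rk d), ι d (eps j) • v = lam (epsH j) • v := by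
    intro j
    have := hI0 _ (Ideal.subset_span (Or.inr ⟨epsH j, rfl⟩))
    rwa [sub_smul, sub_eq_zero, algebraMap_smul] at this
  have hpos : ∀ X ∈ posRootVectors d, ι d X • v = 0 := fun X hX =>
    hI0 _ (Ideal.subset_span (Or.inl ⟨X, hX, rfl⟩))
  have h := pfaffian_smul_of_highestWeight hjk.ne (heps j) (heps k)
    (hpos _ (Or.inl ⟨j, k, hjk, .inl rfl⟩)) (hpos _ (Or.inl ⟨j, k, hjk, .inr rfl⟩))
  have hjk' : (j : ℕ) ≠ k := fun h => hjk.ne (Fin.ext h)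
  have hmem : ι d (wedge (eOdd j) (eEven j)) * ι d (wedge (eOdd k) (eEven k)) -
      ι d (wedge (eOdd j) (eOdd k)) * ι d (wedge (eEven j) (eEven k)) +
      ι d (wedge (eOdd j) (eEven k)) * ι d (wedge (eEven j) (eOdd k)) ∈ Q d := by
    refine pfaffian_mem_Q ?_ ?_ ?_ ?_ ?_ ?_ <;> simp only [ne_eq, Fin.mk.injEq] <;> omega
  rw [hQ _ hmem] at h
  have := (smul_eq_zero.1 h.symm).resolve_right hv
  exact neg_eq_zero.1 this

/-! ### Representations of `so(n+1)` by first order differential operators -/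

theorem sum_sum_eq_zero_of_antisymm {σ V : Type*} [Fintype σ] [AddCommGroup V] [Module ℂ V]
    (f : σ → σ → V) (h : ∀ s t, f s t = -f t s) : ∑ s, ∑ t, f s t = 0 := by
  have h1 : ∑ s, ∑ t, f s t = -∑ s, ∑ t, f s t := by
    conv_lhs => rw [Finset.sum_comm]
    rw [← Finset.sum_neg_distrib]
    refine Finset.sum_congr rfl fun s _ => ?_
    rw [← Finset.sum_neg_distrib]
    exact Finset.sum_congr rfl fun t _ => h t s
  have h2 : (2 : ℂ) • ∑ s, ∑ t, f s t = 0 := by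
    rw [two_smul]
    nth_rewrite 2 [h1]
    exact add_neg_cancel _
  exact (smul_eq_zero.1 h2).resolve_left two_ne_zero

/-- Multiplications and derivatives, indexed by the vectors of `A`: the canonical commutation
relations with respect to the bilinear form of `A`. -/
structure WeylPair {d : ℕ} {E : Type*} [Ring E] [Algebra ℂ E] (Zop Dop : A d →ₗ[ℂ] E) : Prop where
  mul_mul : ∀ u w, Zop u * Zop w = Zop w * Zop u
  der_der : ∀ u w, Dop u * Dop w = Dop w * Dop u
  der_mul : ∀ w u, Dop w * Zop u = Zop u * Dop w + (w ⬝ᵥ u) • 1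

namespace WeylPair

variable {d : ℕ} {E : Type*} [Ring E] [Algebra ℂ E] {Zop Dop : A d →ₗ[ℂ] E}

/-- Normal ordering: multiplications to the left, derivatives to the right, and one contraction. -/
theorem mul_der_mul_der (h : WeylPair Zop Dop) (a b c f : A d) :
    Zop a * Dop b * (Zop c * Dop f) =
      Zop a * Zop c * (Dop b * Dop f) + (b ⬝ᵥ c) • (Zop a * Dop f) := by
  rw [mul_assoc, ← mul_assoc (Dop b), h.der_mul, add_mul, mul_add, smul_mul_assoc, one_mul,
    mul_smul_comm]
  simp only [mul_assoc]

theorem lie_mul_der (h : WeylPair Zop Dop) (a b c f : A d) :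
    Zop a * Dop b * (Zop c * Dop f) - Zop c * Dop f * (Zop a * Dop b) =
      (b ⬝ᵥ c) • (Zop a * Dop f) - (f ⬝ᵥ a) • (Zop c * Dop b) := by
  rw [h.mul_der_mul_der, h.mul_der_mul_der, h.mul_mul c a, h.der_der f b]
  abel

theorem sum_dot_smul_mulVec (X : Matrix (Fin (d + 3)) (Fin (d + 3)) ℂ) (v : A d) :
    ∑ r, (e r ⬝ᵥ v) • Zop (X.mulVec (e r)) = Zop (X.mulVec v) := by
  conv_rhs => rw [eq_sum_smul_e v]
  rw [Matrix.mulVec_sum, map_sum]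
  refine Finset.sum_congr rfl fun r _ => ?_
  rw [Matrix.mulVec_smul, map_smul, e_dotProduct]

/-- The representation `X ↦ ∑ X_{rs} z_r ∂_s` of `so(n+1)`. -/
noncomputable def rep (h : WeylPair Zop Dop) : so d →ₗ⁅ℂ⁆ E where
  toFun X := ∑ r, Zop ((X : Matrix (Fin (d + 3)) (Fin (d + 3)) ℂ).mulVec (e r)) * Dop (e r)
  map_add' X Y := by
    rw [← Finset.sum_add_distrib]
    refine Finset.sum_congr rfl fun r _ => ?_
    rw [AddMemClass.coe_add, Matrix.add_mulVec, map_add, add_mul]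
  map_smul' c X := by
    rw [RingHom.id_apply, Finset.smul_sum]
    refine Finset.sum_congr rfl fun r _ => ?_
    rw [SetLike.val_smul, Matrix.smul_mulVec, map_smul, smul_mul_assoc]
  map_lie' := by
    intro X Y
    rw [Ring.lie_def, Finset.sum_mul_sum, Finset.sum_mul_sum]
    rw [Finset.sum_comm (f := fun s r =>
      Zop ((Y : Matrix (Fin (d + 3)) (Fin (d + 3)) ℂ).mulVec (e s)) * Dop (e s) *
      (Zop ((X : Matrix (Fin (d + 3)) (Fin (d + 3)) ℂ).mulVec (e r)) * Dop (e r)))]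
    rw [← Finset.sum_sub_distrib]
    simp only [← Finset.sum_sub_distrib, h.lie_mul_der]
    simp only [Finset.sum_sub_distrib, LieSubalgebra.coe_bracket, Ring.lie_def, Matrix.sub_mulVec,
      map_sub, sub_mul]
    congr 1
    · rw [Finset.sum_comm]
      refine Finset.sum_congr rfl fun s _ => ?_
      rw [← Matrix.mulVec_mulVec, ← sum_dot_smul_mulVec, Finset.sum_mul]
      simp only [smul_mul_assoc]
    · refine Finset.sum_congr rfl fun s _ => ?_
      rw [← Matrix.mulVec_mulVec, ← sum_dot_smul_mulVec, Finset.sum_mul]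
      simp only [smul_mul_assoc]

theorem rep_apply (h : WeylPair Zop Dop) (X : so d) : h.rep X =
    ∑ r, Zop ((X : Matrix (Fin (d + 3)) (Fin (d + 3)) ℂ).mulVec (e r)) * Dop (e r) := rfl

theorem rep_wedge (h : WeylPair Zop Dop) (u w : A d) :
    h.rep (wedge u w) = Zop u * Dop w - Zop w * Dop u := by
  rw [rep_apply]
  have hD : ∀ v : A d, Dop v = ∑ r, v r • Dop (e r) := fun v => by
    conv_lhs => rw [eq_sum_smul_e v]
    rw [map_sum]
    exact Finset.sum_congr rfl fun r _ => map_smul _ _ _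
  rw [hD w, hD u, Finset.mul_sum, Finset.mul_sum, ← Finset.sum_sub_distrib]
  refine Finset.sum_congr rfl fun r _ => ?_
  rw [wedge_mulVec, dotProduct_comm, dotProduct_comm u, e_dotProduct, e_dotProduct, map_sub,
    map_smul, map_smul, sub_mul, smul_mul_assoc, smul_mul_assoc, mul_smul_comm, mul_smul_comm]

/-- The extension of the representation to the enveloping algebra. -/
noncomputable def repU (h : WeylPair Zop Dop) : U d →ₐ[ℂ] E := UniversalEnvelopingAlgebra.lift ℂ h.rep

theorem repU_ι (h : WeylPair Zop Dop) (X : so d) : h.repU (ι d X) = h.rep X :=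
  UniversalEnvelopingAlgebra.lift_ι_apply ℂ h.rep X

theorem repU_basicTail_e (h : WeylPair Zop Dop) (b : Fin d → A d) (s : Fin (d + 3)) :
    h.repU (basicTail b (e s)) =
      ∑ q, ∑ p, basicEntry p q (Fin.cons (e s) b) • (Zop (e p) * Dop (e q)) := by
  rw [basicTail_apply, repU_ι, rep_apply]
  refine Finset.sum_congr rfl fun q _ => ?_
  have : (basic (Fin.cons (e s) b) : Matrix (Fin (d + 3)) (Fin (d + 3)) ℂ).mulVec (e q) =
      ∑ p, basicEntry p q (Fin.cons (e s) b) • e p := by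
    rw [eq_sum_smul_e (Matrix.mulVec _ _)]
    refine Finset.sum_congr rfl fun p _ => ?_
    rw [← basic_apply]
    simp [e]
  rw [this, map_sum, Finset.sum_mul]
  simp only [map_smul, smul_mul_assoc]

/-- This is where the Weyl algebra satisfies the relations of `Q(A)`. After normal ordering, the
quartic terms contract coefficients antisymmetric in `p, q, s` with two commuting multiplications or
two commuting derivatives, and vanish; the single surviving contraction is the right-hand side. -/
theorem repU_basicTail_eq (h : WeylPair Zop Dop) (b : Fin d → A d) (r : Fin (d + 3)) :
    ∑ s, h.repU (ι d (wedge (e r) (e s)) * basicTail b (e s)) = h.repU (basicTail b (e r)) := by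
  have hsw1 : ∀ s p q, basicEntry p q (Fin.cons (e s) b) = -basicEntry p s (Fin.cons (e q) b) :=
    fun s p q => basicEntry_swap p q s b
  have hsw2 : ∀ s p q, basicEntry p q (Fin.cons (e s) b) = -basicEntry q p (Fin.cons (e s) b) :=
    fun s p q => basicEntry_swap_left p q _
  have hsw3 : ∀ s p q, basicEntry p q (Fin.cons (e s) b) = -basicEntry s q (Fin.cons (e p) b) := by
    intro s p q
    rw [hsw2, hsw1, hsw2, neg_neg]
  have hss : ∀ s q, basicEntry s q (Fin.cons (e s) b) = 0 := fun s q => by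
    linear_combination (hsw3 s s q) / 2
  have hee : ∀ i j : Fin (d + 3), (e i : A d) ⬝ᵥ e j = if i = j then 1 else 0 := fun i j => by
    rw [e_dotProduct]; simp [e, Pi.single_apply]
  have h1 : ∀ s, h.repU (ι d (wedge (e r) (e s)) * basicTail b (e s)) =
      ∑ q, ∑ p, (basicEntry p q (Fin.cons (e s) b) •
          (Zop (e r) * Zop (e p) * (Dop (e s) * Dop (e q)))
        - basicEntry p q (Fin.cons (e s) b) •
          (Zop (e s) * Zop (e p) * (Dop (e r) * Dop (e q)))
        - (if r = p then basicEntry p q (Fin.cons (e s) b) else 0) •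
          (Zop (e s) * Dop (e q))) := by
    intro s
    rw [map_mul, repU_basicTail_e, repU_ι, rep_wedge, Finset.mul_sum]
    refine Finset.sum_congr rfl fun q _ => ?_
    rw [Finset.mul_sum]
    refine Finset.sum_congr rfl fun p _ => ?_
    rw [mul_smul_comm, sub_mul, h.mul_der_mul_der, h.mul_der_mul_der, hee, hee]
    -- The other contraction sets `p = s`, where the antisymmetric coefficient is zero.
    have h0 : basicEntry p q (Fin.cons (e s) b) • (if s = p then (1 : ℂ) else 0) •
        (Zop (e r) * Dop (e q)) = 0 := by
      split_ifs with hsp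
      · subst hsp; rw [hss, zero_smul]
      · rw [zero_smul, smul_zero]
    rw [smul_sub, smul_add, smul_add, h0]
    split_ifs <;> module
  simp only [h1, Finset.sum_sub_distrib]
  rw [repU_basicTail_e]
  have e1 : ∑ s, ∑ q, ∑ p, basicEntry p q (Fin.cons (e s) b) •
          (Zop (e r) * Zop (e p) * (Dop (e s) * Dop (e q))) = 0 := by
    refine sum_sum_eq_zero_of_antisymm _ fun s q => ?_
    rw [← Finset.sum_neg_distrib]
    refine Finset.sum_congr rfl fun p _ => ?_
    rw [hsw1, neg_smul, h.der_der]
  have e2 : ∑ s, ∑ q, ∑ p, basicEntry p q (Fin.cons (e s) b) •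
          (Zop (e s) * Zop (e p) * (Dop (e r) * Dop (e q))) = 0 := by
    rw [Finset.sum_congr rfl fun s _ => Finset.sum_comm]
    refine sum_sum_eq_zero_of_antisymm _ fun s p => ?_
    rw [← Finset.sum_neg_distrib]
    refine Finset.sum_congr rfl fun q _ => ?_
    rw [hsw3, neg_smul, h.mul_mul]
  rw [e1, e2, sub_zero, zero_sub, Finset.sum_comm, ← Finset.sum_neg_distrib]
  refine Finset.sum_congr rfl fun q _ => ?_
  rw [← Finset.sum_neg_distrib]
  refine Finset.sum_congr rfl fun s _ => ?_
  simp only [ite_smul, zero_smul, Finset.sum_ite_eq, Finset.mem_univ, if_true]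
  rw [hsw3, neg_smul, neg_neg]

theorem repU_generatorQ (h : WeylPair Zop Dop) (a : Fin (d + 2) → A d) (b : Fin d → A d) :
    h.repU (generatorQ a b) = 0 := by
  have hT : basicTail b (bracketA d a) = ∑ r, bracketA d a r • basicTail b (e r) := by
    conv_lhs => rw [eq_sum_smul_e (bracketA d a)]
    rw [map_sum]
    exact Finset.sum_congr rfl fun r _ => map_smul _ _ _
  rw [generatorQ_eq, map_sub, sub_eq_zero, hT, map_sum, map_sum]
  refine Finset.sum_congr rfl fun r _ => ?_
  rw [map_smul, ← repU_basicTail_eq, map_sum, Finset.smul_sum]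
  exact Finset.sum_congr rfl fun s _ => by rw [map_smul]

theorem repU_eq_zero_of_mem_Q (h : WeylPair Zop Dop) {q : U d} (hq : q ∈ Q d) : h.repU q = 0 := by
  have hle : Q d ≤ TwoSidedIdeal.ker h.repU.toRingHom := by
    refine TwoSidedIdeal.span_le.2 ?_
    rintro _ ⟨a, b, rfl⟩
    exact (TwoSidedIdeal.mem_ker _).2 (h.repU_generatorQ a b)
  exact (TwoSidedIdeal.mem_ker _).1 (hle hq)

end WeylPair

/-! ### The isotropic basis -/

theorem sum_range_two_mul (g : ℕ → ℂ) (N : ℕ) :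
    ∑ i ∈ Finset.range (2 * N), g i = ∑ j ∈ Finset.range N, (g (2 * j) + g (2 * j + 1)) := by
  induction N with
  | zero => simp
  | succ N ih =>
    rw [Finset.sum_range_succ, ← ih, mul_add, mul_one, Finset.sum_range_succ,
      Finset.sum_range_succ, add_assoc]

theorem sum_coordinates {d : ℕ} (u w : A d) :
    u ⬝ᵥ w = ∑ j : Fin (rk d), ((eOdd j ⬝ᵥ u) * (eOdd j ⬝ᵥ w) + (eEven j ⬝ᵥ u) * (eEven j ⬝ᵥ w)) +
      if Odd (d + 3) then u (Fin.last (d + 2)) * w (Fin.last (d + 2)) else 0 := by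
  let g : ℕ → ℂ := fun i => if h : i < d + 3 then u ⟨i, h⟩ * w ⟨i, h⟩ else 0
  have h1 : u ⬝ᵥ w = ∑ i ∈ Finset.range (d + 3), g i := by
    rw [Finset.sum_range]
    exact Finset.sum_congr rfl fun i _ => by simp [g]
  have h2 : ∑ j : Fin (rk d), ((eOdd j ⬝ᵥ u) * (eOdd j ⬝ᵥ w) + (eEven j ⬝ᵥ u) * (eEven j ⬝ᵥ w)) =
      ∑ i ∈ Finset.range (2 * rk d), g i := by
    rw [sum_range_two_mul, Finset.sum_range]
    refine Finset.sum_congr rfl fun j _ => ?_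
    have hj : (j : ℕ) < (d + 3) / 2 := j.2
    have ha : 2 * (j : ℕ) < d + 3 := by omega
    have hb : 2 * (j : ℕ) + 1 < d + 3 := by omega
    simp only [g, dif_pos ha, dif_pos hb, eOdd, eEven, e_dotProduct]
  rw [h1, h2]
  split_ifs with ho
  · have hN : d + 3 = 2 * rk d + 1 := by
      have : d + 3 = 2 * ((d + 3) / 2) + 1 := by
        have := Nat.odd_iff.1 ho; omega
      exact this
    have hg : g (2 * rk d) = u (Fin.last (d + 2)) * w (Fin.last (d + 2)) := by
      have : 2 * rk d = d + 2 := by omega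
      rw [this]
      simp only [g]
      rw [dif_pos (by omega)]
      rfl
    rw [← hg, ← Finset.sum_range_succ, ← hN]
  · have hN : d + 3 = 2 * rk d := by
      have : d + 3 = 2 * ((d + 3) / 2) := by
        have := Nat.even_iff.1 (Nat.not_odd_iff_even.1 ho); omega
      exact this
    rw [add_zero, ← hN]

/-- The index set of the isotropic basis: positive, negative, and (in odd dimension) zero. -/
abbrev IsoIndex (d : ℕ) : Type := (Fin (rk d) ⊕ Fin (rk d)) ⊕ Unit

/-- The isotropic basis of `A`. In even dimension, the vector of index zero is `0`. -/
noncomputable def isoVec {d : ℕ} : IsoIndex d → A d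
  | .inl (.inl j) => vPos j
  | .inl (.inr j) => vNeg j
  | .inr _ => if Odd (d + 3) then e (Fin.last (d + 2)) else 0

/-- The dual of the isotropic basis. -/
noncomputable def isoDual {d : ℕ} : IsoIndex d → A d
  | .inl (.inl j) => vNeg j
  | .inl (.inr j) => vPos j
  | .inr _ => if Odd (d + 3) then e (Fin.last (d + 2)) else 0

/-- The resolution of the identity by dual isotropic families. It also holds in even dimension,
where the extra vector is zero; only this identity is needed, not linear independence. -/
theorem sum_isoVec_dot {d : ℕ} (u w : A d) :
    ∑ κ, (u ⬝ᵥ isoVec κ) * (w ⬝ᵥ isoDual κ) = u ⬝ᵥ w := by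
  rw [sum_coordinates u w, Fintype.sum_sum_type, Fintype.sum_sum_type, ← Finset.sum_add_distrib]
  congr 1
  · refine Finset.sum_congr rfl fun j _ => ?_
    simp only [isoVec, isoDual, vPos, vNeg, dotProduct_smul, dotProduct_add, dotProduct_sub,
      smul_eq_mul]
    rw [dotProduct_comm u (eOdd j), dotProduct_comm u (eEven j), dotProduct_comm w (eOdd j),
      dotProduct_comm w (eEven j)]
    linear_combination 2 * ((eOdd j ⬝ᵥ u) * (eOdd j ⬝ᵥ w) + (eEven j ⬝ᵥ u) * (eEven j ⬝ᵥ w)) *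
      inv_sqrt_two_sq - 2 * (((Real.sqrt 2 : ℝ) : ℂ)⁻¹ * ((Real.sqrt 2 : ℝ) : ℂ)⁻¹) *
      (eEven j ⬝ᵥ u) * (eEven j ⬝ᵥ w) * Complex.I_mul_I
  · simp only [Finset.univ_unique, Finset.sum_singleton, isoVec, isoDual]
    split_ifs
    · rw [dotProduct_comm, e_dotProduct, dotProduct_comm, e_dotProduct]
    · simp

theorem eq_sum_isoVec {d : ℕ} (u : A d) : u = ∑ κ, (u ⬝ᵥ isoDual κ) • isoVec κ := by
  ext i
  rw [← e_dotProduct i u, ← sum_isoVec_dot, Finset.sum_apply]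
  refine Finset.sum_congr rfl fun κ _ => ?_
  rw [e_dotProduct, Pi.smul_apply, smul_eq_mul, mul_comm]

theorem vPos_apply_last {d : ℕ} (ho : Odd (d + 3)) (j : Fin (rk d)) :
    (vPos j : A d) (Fin.last (d + 2)) = 0 := by
  have hj : (j : ℕ) < (d + 3) / 2 := j.2
  have := Nat.odd_iff.1 ho
  have h1 : ¬ (d + 2 = 2 * (j : ℕ)) := by omega
  have h2 : ¬ (d + 2 = 2 * (j : ℕ) + 1) := by omega
  simp [vPos, eOdd, eEven, e, Fin.ext_iff, h1, h2]

theorem vNeg_apply_last {d : ℕ} (ho : Odd (d + 3)) (j : Fin (rk d)) :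
    (vNeg j : A d) (Fin.last (d + 2)) = 0 := by
  have hj : (j : ℕ) < (d + 3) / 2 := j.2
  have := Nat.odd_iff.1 ho
  have h1 : ¬ (d + 2 = 2 * (j : ℕ)) := by omega
  have h2 : ¬ (d + 2 = 2 * (j : ℕ) + 1) := by omega
  simp [vNeg, eOdd, eEven, e, Fin.ext_iff, h1, h2]

/-! ### Monomial modules of the Weyl algebra -/

section Monomial

variable {σ : Type*} [DecidableEq σ]

/-- Multiplication by a coordinate, on (possibly infinite) Laurent series. -/
def shiftOp (a : σ) : Module.End ℂ ((σ → ℤ) → ℂ) where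
  toFun ψ m := ψ (m - Pi.single a 1)
  map_add' _ _ := rfl
  map_smul' _ _ := rfl

/-- The derivative with respect to a coordinate, on Laurent series multiplied by the monomial
with exponents `s`. -/
def derivOp (s : σ → ℂ) (a : σ) : Module.End ℂ ((σ → ℤ) → ℂ) where
  toFun ψ m := ((m a : ℂ) + 1 + s a) * ψ (m + Pi.single a 1)
  map_add' _ _ := by ext m; simp [mul_add]
  map_smul' _ _ := by ext m; simp; ring

theorem shiftOp_apply (a : σ) (ψ : (σ → ℤ) → ℂ) (m : σ → ℤ) :
    shiftOp a ψ m = ψ (m - Pi.single a 1) := rfl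

theorem derivOp_apply (s : σ → ℂ) (a : σ) (ψ : (σ → ℤ) → ℂ) (m : σ → ℤ) :
    derivOp s a ψ m = ((m a : ℂ) + 1 + s a) * ψ (m + Pi.single a 1) := rfl

theorem shiftOp_comm (a b : σ) : shiftOp a * shiftOp b = shiftOp b * shiftOp a := by
  ext ψ m
  simp only [Module.End.mul_apply, shiftOp_apply]
  congr 1; abel

theorem derivOp_comm (s : σ → ℂ) (a b : σ) :
    derivOp s a * derivOp s b = derivOp s b * derivOp s a := by
  by_cases h : a = b
  · rw [h]
  ext ψ m
  simp only [Module.End.mul_apply, derivOp_apply, Pi.add_apply, Pi.single_eq_of_ne h,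
    Pi.single_eq_of_ne (Ne.symm h), add_zero]
  rw [add_right_comm m]
  ring

theorem derivOp_shiftOp (s : σ → ℂ) (a b : σ) :
    derivOp s a * shiftOp b = shiftOp b * derivOp s a + if a = b then 1 else 0 := by
  ext ψ m
  by_cases h : a = b
  · subst h
    simp only [if_true, Module.End.mul_apply, LinearMap.add_apply, Pi.add_apply, derivOp_apply,
      shiftOp_apply, Pi.sub_apply, Pi.single_eq_same, Module.End.one_apply, sub_add_cancel,
      add_sub_cancel_right]
    push_cast; ring
  · simp only [if_neg h, add_zero, Module.End.mul_apply, derivOp_apply,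
      shiftOp_apply, Pi.sub_apply, Pi.single_eq_of_ne h, sub_zero]
    congr 2; abel

/-- The coordinates, after a Fourier transform in the variables of `F`. -/
def mulOp (s : σ → ℂ) (F : σ → Bool) (a : σ) : Module.End ℂ ((σ → ℤ) → ℂ) :=
  if F a then derivOp s a else shiftOp a

/-- The derivatives, after a Fourier transform in the variables of `F`. -/
def derOp (s : σ → ℂ) (F : σ → Bool) (a : σ) : Module.End ℂ ((σ → ℤ) → ℂ) :=
  if F a then (-1 : ℂ) • shiftOp a else derivOp s a

theorem mulOp_comm (s : σ → ℂ) (F : σ → Bool) (a b : σ) :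
    mulOp s F a * mulOp s F b = mulOp s F b * mulOp s F a := by
  by_cases h : a = b
  · rw [h]
  unfold mulOp
  split_ifs
  · exact derivOp_comm s a b
  · rw [derivOp_shiftOp, if_neg h, add_zero]
  · rw [derivOp_shiftOp, if_neg (Ne.symm h), add_zero]
  · exact shiftOp_comm a b

theorem derOp_comm (s : σ → ℂ) (F : σ → Bool) (a b : σ) :
    derOp s F a * derOp s F b = derOp s F b * derOp s F a := by
  by_cases h : a = b
  · rw [h]
  unfold derOp
  split_ifs
  · rw [smul_mul_smul_comm, smul_mul_smul_comm, shiftOp_comm]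
  · rw [mul_smul_comm, smul_mul_assoc, derivOp_shiftOp, if_neg (Ne.symm h), add_zero]
  · rw [mul_smul_comm, smul_mul_assoc, derivOp_shiftOp, if_neg h, add_zero]
  · exact derivOp_comm s a b

/-- The substitution `(z, ∂) ↦ (∂, -z)` preserves the canonical commutation relations. -/
theorem derOp_mulOp (s : σ → ℂ) (F : σ → Bool) (a b : σ) :
    derOp s F a * mulOp s F b = mulOp s F b * derOp s F a + if a = b then 1 else 0 := by
  by_cases h : a = b
  · subst h
    unfold derOp mulOp
    rw [if_pos rfl]
    split_ifs
    · rw [mul_smul_comm, smul_mul_assoc, derivOp_shiftOp, if_pos rfl]; module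
    · rw [derivOp_shiftOp, if_pos rfl]
  · unfold derOp mulOp
    rw [if_neg h, add_zero]
    split_ifs
    · rw [mul_smul_comm, smul_mul_assoc, derivOp_shiftOp, if_neg (Ne.symm h), add_zero]
    · rw [mul_smul_comm, smul_mul_assoc, shiftOp_comm]
    · exact derivOp_comm s a b
    · rw [derivOp_shiftOp, if_neg h, add_zero]

/-- Euler operators are diagonal on monomials. For a Fourier transformed variable `z∂` becomes `-(z∂
+ 1)`; on the base monomial with exponent zero its value is `-1`, the source of the entries `-1` in
the weights. -/
theorem mulOp_derOp_apply (s : σ → ℂ) (F : σ → Bool) (a : σ) (ψ : (σ → ℤ) → ℂ) (m : σ → ℤ) :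
    mulOp s F a (derOp s F a ψ) m =
      (if F a then -((m a : ℂ) + 1 + s a) else (m a : ℂ) + s a) * ψ m := by
  unfold mulOp derOp
  split_ifs
  · simp only [LinearMap.smul_apply, Pi.smul_apply, smul_eq_mul, derivOp_apply, shiftOp_apply,
      add_sub_cancel_right]
    ring
  · simp only [derivOp_apply, shiftOp_apply, sub_add_cancel, Pi.sub_apply, Pi.single_eq_same]
    push_cast; ring

variable [Fintype σ]

variable (σ) in
/-- The monomial with exponents `0`. -/
def baseVec : (σ → ℤ) → ℂ := Pi.single 0 1

theorem derivOp_baseVec {s : σ → ℂ} {a : σ} (h : s a = 0) : derivOp s a (baseVec σ) = 0 := by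
  ext m
  rw [derivOp_apply, baseVec, Pi.single_apply]
  split_ifs with hm
  · have : m a = -1 := by
      have := congrFun hm a
      simp at this; omega
    rw [this, h]; simp
  · simp

end Monomial

/-! ### The Weyl pair of the isotropic coordinates -/

/-- The multiplication operators of the isotropic coordinates, extended linearly to `A`. -/
noncomputable def isoMul {d : ℕ} (s : IsoIndex d → ℂ) (F : IsoIndex d → Bool) :
    A d →ₗ[ℂ] Module.End ℂ ((IsoIndex d → ℤ) → ℂ) where
  toFun u := ∑ κ, (u ⬝ᵥ isoDual κ) • mulOp s F κ
  map_add' u w := by simp only [add_dotProduct, add_smul, Finset.sum_add_distrib]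
  map_smul' c u := by
    simp only [smul_dotProduct, smul_eq_mul, mul_smul, Finset.smul_sum, RingHom.id_apply]

/-- The derivatives with respect to the isotropic coordinates, extended linearly to `A`. -/
noncomputable def isoDer {d : ℕ} (s : IsoIndex d → ℂ) (F : IsoIndex d → Bool) :
    A d →ₗ[ℂ] Module.End ℂ ((IsoIndex d → ℤ) → ℂ) where
  toFun u := ∑ κ, (u ⬝ᵥ isoVec κ) • derOp s F κ
  map_add' u w := by simp only [add_dotProduct, add_smul, Finset.sum_add_distrib]
  map_smul' c u := by
    simp only [smul_dotProduct, smul_eq_mul, mul_smul, Finset.smul_sum, RingHom.id_apply]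

section Iso

variable {d : ℕ} (s : IsoIndex d → ℂ) (F : IsoIndex d → Bool)

theorem isoMul_apply (u : A d) : isoMul s F u = ∑ κ, (u ⬝ᵥ isoDual κ) • mulOp s F κ := rfl

theorem isoDer_apply (u : A d) : isoDer s F u = ∑ κ, (u ⬝ᵥ isoVec κ) • derOp s F κ := rfl

theorem weylPair_iso : WeylPair (isoMul s F) (isoDer s F) where
  mul_mul u w := by
    rw [isoMul_apply, isoMul_apply, Finset.sum_mul_sum, Finset.sum_mul_sum, Finset.sum_comm]
    refine Finset.sum_congr rfl fun a _ => Finset.sum_congr rfl fun b _ => ?_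
    rw [smul_mul_smul_comm, smul_mul_smul_comm, mulOp_comm, mul_comm]
  der_der u w := by
    rw [isoDer_apply, isoDer_apply, Finset.sum_mul_sum, Finset.sum_mul_sum, Finset.sum_comm]
    refine Finset.sum_congr rfl fun a _ => Finset.sum_congr rfl fun b _ => ?_
    rw [smul_mul_smul_comm, smul_mul_smul_comm, derOp_comm, mul_comm]
  der_mul w u := by
    have h : (w ⬝ᵥ u) • (1 : Module.End ℂ ((IsoIndex d → ℤ) → ℂ)) =
        ∑ a, ∑ b, ((w ⬝ᵥ isoVec a) * (u ⬝ᵥ isoDual b)) • (if a = b then 1 else 0) := by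
      rw [← sum_isoVec_dot, Finset.sum_smul]
      refine Finset.sum_congr rfl fun a _ => ?_
      simp
    rw [h, isoMul_apply, isoDer_apply, Finset.sum_mul_sum, Finset.sum_mul_sum]
    rw [Finset.sum_comm (f := fun b a => (u ⬝ᵥ isoDual b) • mulOp s F b *
      (w ⬝ᵥ isoVec a) • derOp s F a), ← Finset.sum_add_distrib]
    refine Finset.sum_congr rfl fun a _ => ?_
    rw [← Finset.sum_add_distrib]
    refine Finset.sum_congr rfl fun b _ => ?_
    rw [smul_mul_smul_comm, smul_mul_smul_comm, derOp_mulOp, smul_add, mul_comm (u ⬝ᵥ isoDual b)]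

theorem isoMul_vPos (j : Fin (rk d)) : isoMul s F (vPos j) = mulOp s F (.inl (.inl j)) := by
  rw [isoMul_apply, Fintype.sum_sum_type, Fintype.sum_sum_type]
  simp only [isoDual, vPos_dot_vNeg, vPos_dot_vPos, zero_smul, Finset.sum_const_zero, add_zero,
    ite_smul, one_smul, Finset.sum_ite_eq, Finset.mem_univ, if_true]
  split_ifs with ho
  · rw [dotProduct_comm, e_dotProduct, vPos_apply_last ho]; simp
  · simp

theorem isoMul_vNeg (j : Fin (rk d)) : isoMul s F (vNeg j) = mulOp s F (.inl (.inr j)) := by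
  rw [isoMul_apply, Fintype.sum_sum_type, Fintype.sum_sum_type]
  simp only [isoDual, vNeg_dot_vNeg, vNeg_dot_vPos, zero_smul, Finset.sum_const_zero, zero_add,
    ite_smul, one_smul, Finset.sum_ite_eq, Finset.mem_univ, if_true]
  split_ifs with ho
  · rw [dotProduct_comm, e_dotProduct, vNeg_apply_last ho]; simp
  · simp

/-- Derivatives are indexed through the bilinear form, for which `v_j` is dual to `v_{-j}`; hence
the variable changes sign. -/
theorem isoDer_vPos (j : Fin (rk d)) : isoDer s F (vPos j) = derOp s F (.inl (.inr j)) := by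
  rw [isoDer_apply, Fintype.sum_sum_type, Fintype.sum_sum_type]
  simp only [isoVec, vPos_dot_vNeg, vPos_dot_vPos, zero_smul, Finset.sum_const_zero, zero_add,
    ite_smul, one_smul, Finset.sum_ite_eq, Finset.mem_univ, if_true]
  split_ifs with ho
  · rw [dotProduct_comm, e_dotProduct, vPos_apply_last ho]; simp
  · simp

theorem isoDer_vNeg (j : Fin (rk d)) : isoDer s F (vNeg j) = derOp s F (.inl (.inl j)) := by
  rw [isoDer_apply, Fintype.sum_sum_type, Fintype.sum_sum_type]
  simp only [isoVec, vNeg_dot_vNeg, vNeg_dot_vPos, zero_smul, Finset.sum_const_zero, add_zero,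
    ite_smul, one_smul, Finset.sum_ite_eq, Finset.mem_univ, if_true]
  split_ifs with ho
  · rw [dotProduct_comm, e_dotProduct, vNeg_apply_last ho]; simp
  · simp

theorem isoDer_e_last (ho : Odd (d + 3)) :
    isoDer s F (e (Fin.last (d + 2))) = derOp s F (.inr ()) := by
  rw [isoDer_apply, Fintype.sum_sum_type, Fintype.sum_sum_type]
  simp only [isoVec, e_dotProduct, vPos_apply_last ho, vNeg_apply_last ho, if_pos ho]
  simp [e]

end Iso

/-! ### A highest weight vector annihilated by `Q(A)` -/

section HighestWeight

variable {d : ℕ} (t : Fin (rk d)) (x : ℂ)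

/-- The exponent `x` in the `t`-th positive variable. -/
def hwExponent : IsoIndex d → ℂ
  | .inl (.inl j) => if j = t then x else 0
  | _ => 0

/-- The positive variables before the `t`-th are Fourier transformed. -/
def hwFourier : IsoIndex d → Bool
  | .inl (.inl j) => decide (j < t)
  | _ => false

/-- The representation of `U` whose base vector has weight `(-1, …, -1, x, 0, …, 0)`. -/
noncomputable def hwRep : U d →ₐ[ℂ] Module.End ℂ ((IsoIndex d → ℤ) → ℂ) :=
  (weylPair_iso (hwExponent t x) (hwFourier t)).repU

theorem hwRep_eps (j : Fin (rk d)) (ψ : (IsoIndex d → ℤ) → ℂ) (m : IsoIndex d → ℤ) :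
    hwRep t x (ι d (eps j)) ψ m =
      ((if j < t then -1 - (m (.inl (.inl j)) : ℂ)
          else m (.inl (.inl j)) + if j = t then x else 0)
        - m (.inl (.inr j))) * ψ m := by
  rw [hwRep, WeylPair.repU_ι, ← wedge_vPos_vNeg, WeylPair.rep_wedge, isoMul_vPos, isoMul_vNeg,
    isoDer_vPos, isoDer_vNeg, LinearMap.sub_apply, Pi.sub_apply, Module.End.mul_apply,
    Module.End.mul_apply, mulOp_derOp_apply, mulOp_derOp_apply]
  simp only [hwExponent, hwFourier, decide_eq_true_eq, Bool.false_eq_true, if_false]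
  split_ifs with h1 h2
  · exact absurd h2 h1.ne
  all_goals ring

theorem derOp_neg_baseVec (j : Fin (rk d)) :
    derOp (hwExponent t x) (hwFourier t) (.inl (.inr j)) (baseVec (IsoIndex d)) = 0 := by
  rw [derOp, if_neg (by simp [hwFourier])]
  exact derivOp_baseVec rfl

/-- Derivatives in the negative and zero variables kill the base vector, whose exponents there are
zero. What remains is the term `z_j ∂_k` of `v_j ∧ v_{-k}`. -/
theorem hwRep_posRootVectors {X : so d} (hX : X ∈ posRootVectors d) :
    hwRep t x (ι d X) (baseVec (IsoIndex d)) = 0 := by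
  rw [hwRep, WeylPair.repU_ι]
  rcases hX with ⟨j, k, hjk, rfl | rfl⟩ | ⟨ho, j, rfl⟩
  · rw [WeylPair.rep_wedge, isoDer_vPos, isoDer_vPos, LinearMap.sub_apply, Module.End.mul_apply,
      Module.End.mul_apply, derOp_neg_baseVec, derOp_neg_baseVec, map_zero, map_zero, sub_zero]
  · rw [WeylPair.rep_wedge, isoDer_vPos, isoDer_vNeg, isoMul_vPos, LinearMap.sub_apply,
      Module.End.mul_apply, Module.End.mul_apply, derOp_neg_baseVec, map_zero, sub_zero]
    -- If `k ≤ t`, then `j < t`: the operator `z_j` is a derivative after the Fourier transform, and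
    -- kills the base vector once it is commuted past `∂_k`. If `k > t`, then `∂_k` is an ordinary
    -- derivative in a variable of exponent zero.
    by_cases hk : k ≤ t
    · rw [← Module.End.mul_apply]
      have hc := derOp_mulOp (hwExponent t x) (hwFourier t) (.inl (.inl k)) (.inl (.inl j))
      rw [if_neg (by simpa using hjk.ne'), add_zero] at hc
      rw [← hc, Module.End.mul_apply, mulOp,
        if_pos (by simpa [hwFourier] using lt_of_lt_of_le hjk hk), derivOp_baseVec, map_zero]
      simp [hwExponent, (lt_of_lt_of_le hjk hk).ne]
    · rw [derOp, if_neg (by simpa [hwFourier] using (not_le.1 hk).le), derivOp_baseVec, map_zero]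
      simp [hwExponent, (not_le.1 hk).ne']
  · rw [WeylPair.rep_wedge, isoDer_vPos, isoDer_e_last _ _ ho, LinearMap.sub_apply,
      Module.End.mul_apply, Module.End.mul_apply, derOp_neg_baseVec, map_zero, derOp,
      if_neg (by simp [hwFourier]),
      derivOp_baseVec (s := hwExponent t x) (a := .inr ()) rfl, map_zero, sub_zero]

end HighestWeight

/-! ### Triangular decomposition -/

theorem linearMap_H_ext {d : ℕ} {V : Type*} [AddCommGroup V] [Module ℂ V] {f g : H d →ₗ[ℂ] V}
    (h : ∀ j, f (epsH j) = g (epsH j)) : f = g := by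
  ext ⟨X, hX⟩
  refine Submodule.span_induction (p := fun X hX => f ⟨X, hX⟩ = g ⟨X, hX⟩) ?_ ?_ ?_ ?_ hX
  · rintro _ ⟨j, rfl⟩
    exact h j
  · exact (map_zero f).trans (map_zero g).symm
  · intro X Y hX hY h1 h2
    have := congrArg₂ (· + ·) h1 h2
    simp only [← map_add] at this
    exact this
  · intro c X hX h1
    have := congrArg (c • ·) h1
    simp only [← map_smul] at this
    exact this

section Triangular

variable {d : ℕ}

/-- A regular element of the Cartan subalgebra, with positive integer eigenvalues on the positive
root vectors. -/
noncomputable def grading (d : ℕ) : H d := ∑ j : Fin (rk d), ((rk d : ℂ) - (j : ℕ)) • epsH j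

theorem coe_grading : ((grading d : H d) : so d) =
    ∑ j : Fin (rk d), ((rk d : ℂ) - (j : ℕ)) • eps j := by
  rw [grading, AddSubmonoidClass.coe_finsetSum]
  rfl

theorem grading_mulVec (v : A d) :
    (((grading d : H d) : so d) : Matrix (Fin (d + 3)) (Fin (d + 3)) ℂ).mulVec v =
      ∑ j : Fin (rk d), ((rk d : ℂ) - (j : ℕ)) • ((vNeg j ⬝ᵥ v) • vPos j - (vPos j ⬝ᵥ v) • vNeg j) := by
  rw [coe_grading, AddSubmonoidClass.coe_finsetSum, Matrix.sum_mulVec]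
  refine Finset.sum_congr rfl fun j _ => ?_
  rw [SetLike.val_smul, Matrix.smul_mulVec, ← wedge_vPos_vNeg, wedge_mulVec]

theorem grading_vPos (k : Fin (rk d)) :
    (((grading d : H d) : so d) : Matrix (Fin (d + 3)) (Fin (d + 3)) ℂ).mulVec (vPos k) =
      ((rk d : ℂ) - (k : ℕ)) • vPos k := by
  rw [grading_mulVec, Finset.sum_eq_single k]
  · rw [vNeg_dot_vPos, vPos_dot_vPos, if_pos rfl]; module
  · intro j _ hj
    rw [vNeg_dot_vPos, vPos_dot_vPos, if_neg hj]; module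
  · simp

theorem grading_vNeg (k : Fin (rk d)) :
    (((grading d : H d) : so d) : Matrix (Fin (d + 3)) (Fin (d + 3)) ℂ).mulVec (vNeg k) =
      (-((rk d : ℂ) - (k : ℕ))) • vNeg k := by
  rw [grading_mulVec, Finset.sum_eq_single k]
  · rw [vNeg_dot_vNeg, vPos_dot_vNeg, if_pos rfl]; module
  · intro j _ hj
    rw [vNeg_dot_vNeg, vPos_dot_vNeg, if_neg hj]; module
  · simp

theorem grading_e_last (ho : Odd (d + 3)) :
    (((grading d : H d) : so d) : Matrix (Fin (d + 3)) (Fin (d + 3)) ℂ).mulVec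
      (e (Fin.last (d + 2))) = (0 : ℂ) • e (Fin.last (d + 2)) := by
  rw [grading_mulVec, zero_smul]
  refine Finset.sum_eq_zero fun j _ => ?_
  rw [dotProduct_comm, dotProduct_comm (vPos j), e_dotProduct, e_dotProduct, vPos_apply_last ho,
    vNeg_apply_last ho]
  module

variable (d) in
/-- Elements of negative integer degree. -/
def negDegree : Set (so d) :=
  {Y | ∃ s : ℕ, 1 ≤ s ∧ ⁅((grading d : H d) : so d), Y⁆ = (-(s : ℂ)) • Y}

theorem wedge_mem_negDegree {u w : A d} {a b : ℂ}
    (hu : (((grading d : H d) : so d) : Matrix (Fin (d + 3)) (Fin (d + 3)) ℂ).mulVec u = a • u)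
    (hw : (((grading d : H d) : so d) : Matrix (Fin (d + 3)) (Fin (d + 3)) ℂ).mulVec w = b • w)
    (s : ℕ) (hs : 1 ≤ s) (hab : a + b = -(s : ℂ)) : wedge u w ∈ negDegree d := by
  refine ⟨s, hs, ?_⟩
  rw [lie_wedge, hu, hw, wedge_smul_left, wedge_smul_right, ← add_smul, hab]

/-- The degrees of `v_1, …, v_N` are `N, …, 1`. Hence, up to sign, a wedge of two isotropic vectors
is zero, a positive root vector, some `ε_j`, or of negative degree. -/
theorem wedge_isoVec_mem (P : Submodule ℂ (so d)) (hpos : posRootVectors d ⊆ P)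
    (heps : ∀ j, eps j ∈ P) (hneg : negDegree d ⊆ P) (κ κ' : IsoIndex d) :
    wedge (isoVec κ) (isoVec κ') ∈ P := by
  have hswap : ∀ u w : A d, wedge u w ∈ P → wedge w u ∈ P := fun u w h => by
    rw [wedge_swap]; exact P.neg_mem h
  have hz : ∀ u : A d, wedge u 0 ∈ P := fun u => by
    rw [← wedgeBilin_apply, map_zero]; exact P.zero_mem
  have hlt : ∀ j : Fin (rk d), (j : ℕ) < rk d := fun j => j.2
  have hpp : ∀ j k : Fin (rk d), wedge (vPos j : A d) (vPos k) ∈ P := by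
    intro j k
    rcases lt_trichotomy j k with h | rfl | h
    · exact hpos (.inl ⟨j, k, h, .inl rfl⟩)
    · rw [wedge_self]; exact P.zero_mem
    · exact hswap _ _ (hpos (.inl ⟨k, j, h, .inl rfl⟩))
  have hpn : ∀ j k : Fin (rk d), wedge (vPos j : A d) (vNeg k) ∈ P := by
    intro j k
    rcases lt_trichotomy j k with h | rfl | h
    · exact hpos (.inl ⟨j, k, h, .inr rfl⟩)
    · rw [wedge_vPos_vNeg]; exact heps j
    · have h' : (k : ℕ) < j := h
      refine hneg (wedge_mem_negDegree (grading_vPos j) (grading_vNeg k) (j - k) (by omega) ?_)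
      rw [Nat.cast_sub h'.le]; ring
  have hnn : ∀ j k : Fin (rk d), wedge (vNeg j : A d) (vNeg k) ∈ P := by
    intro j k
    refine hneg (wedge_mem_negDegree (grading_vNeg j) (grading_vNeg k)
      ((rk d - j) + (rk d - k)) (by have := hlt j; omega) ?_)
    rw [Nat.cast_add, Nat.cast_sub (hlt j).le, Nat.cast_sub (hlt k).le]; ring
  have hop : ∀ j : Fin (rk d), wedge (isoVec (.inr ()) : A d) (vPos j) ∈ P := by
    intro j
    by_cases ho : Odd (d + 3)
    · rw [isoVec, if_pos ho]; exact hpos (.inr ⟨ho, j, rfl⟩)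
    · rw [isoVec, if_neg ho]; exact hswap _ _ (hz _)
  have hon : ∀ j : Fin (rk d), wedge (isoVec (.inr ()) : A d) (vNeg j) ∈ P := by
    intro j
    by_cases ho : Odd (d + 3)
    · rw [isoVec, if_pos ho]
      refine hneg (wedge_mem_negDegree (grading_e_last ho) (grading_vNeg j) (rk d - j)
        (by have := hlt j; omega) ?_)
      rw [Nat.cast_sub (hlt j).le]; ring
    · rw [isoVec, if_neg ho]; exact hswap _ _ (hz _)
  rcases κ with (j | j) | ⟨⟩ <;> rcases κ' with (k | k) | ⟨⟩
  · exact hpp j k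
  · exact hpn j k
  · exact hswap _ _ (hop j)
  · exact hswap _ _ (hpn k j)
  · exact hnn j k
  · exact hswap _ _ (hon j)
  · exact hop k
  · exact hon k
  · rw [wedge_self]; exact P.zero_mem

theorem eq_top_of_triangular (P : Submodule ℂ (so d)) (hpos : posRootVectors d ⊆ P)
    (heps : ∀ j, eps j ∈ P) (hneg : negDegree d ⊆ P) (X : so d) : X ∈ P := by
  have hw : ∀ u w : A d, wedge u w ∈ P := by
    intro u w
    rw [eq_sum_isoVec u, eq_sum_isoVec w, ← wedgeBilin_apply, map_sum]
    refine P.sum_mem fun κ' _ => ?_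
    rw [map_smul, map_sum, LinearMap.sum_apply]
    refine P.smul_mem _ (P.sum_mem fun κ _ => ?_)
    rw [map_smul, LinearMap.smul_apply]
    exact P.smul_mem _ (wedge_isoVec_mem P hpos heps hneg κ κ')
  rw [so_eq_sum X]
  exact P.smul_mem _ (P.sum_mem fun r _ => P.sum_mem fun s _ => P.smul_mem _ (hw _ _))

variable (lam : Module.Dual ℂ (H d))

/-- The spanning half of the triangular decomposition: modulo `I(λ)`, `U` is spanned by products of
elements of negative degree. It suffices to treat the smallest subspace `T` with the given closure
properties and to show that `T` is stable under `so(n+1)`. -/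
theorem mem_of_negDegree_mul_mem (S : Submodule ℂ (U d)) (hI : ∀ u ∈ I lam, u ∈ S) (h1 : 1 ∈ S)
    (hS : ∀ Y ∈ negDegree d, ∀ u ∈ S, ι d Y * u ∈ S) (u : U d) : u ∈ S := by
  let C : Set (Submodule ℂ (U d)) := {S | (∀ u ∈ I lam, u ∈ S) ∧ 1 ∈ S ∧
    ∀ Y ∈ negDegree d, ∀ u ∈ S, ι d Y * u ∈ S}
  have hT : sInf C ∈ C := by
    refine ⟨fun u hu => ?_, ?_, fun Y hY u hu => ?_⟩
    · exact (Submodule.mem_sInf).2 fun S hS => hS.1 u hu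
    · exact (Submodule.mem_sInf).2 fun S hS => hS.2.1
    · exact (Submodule.mem_sInf).2 fun S hS => hS.2.2 Y hY u ((Submodule.mem_sInf).1 hu S hS)
  set T := sInf C with hTdef
  obtain ⟨hTI, hT1, hTn⟩ := hT
  have hleft : ∀ (v : U d), ∃ L : Submodule ℂ (so d), ∀ X, X ∈ L ↔ ι d X * v ∈ T := fun v =>
    ⟨T.comap ((LinearMap.mulRight ℂ v) ∘ₗ (ι d : so d →ₗ[ℂ] U d)), fun X => Iff.rfl⟩
  have hX1 : ∀ X : so d, ι d X * 1 ∈ T := by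
    obtain ⟨L, hL⟩ := hleft 1
    intro X
    refine (hL X).1 (eq_top_of_triangular L ?_ ?_ ?_ X)
    · intro X hX
      refine (hL X).2 ?_
      rw [mul_one]
      exact hTI _ (Ideal.subset_span (.inl ⟨X, hX, rfl⟩))
    · intro j
      refine (hL _).2 ?_
      have h1 : ι d (eps j) - algebraMap ℂ (U d) (lam (epsH j)) ∈ T :=
        hTI _ (Ideal.subset_span (.inr ⟨epsH j, rfl⟩))
      have h2 := T.add_mem h1 (T.smul_mem (lam (epsH j)) hT1)
      rwa [← Algebra.algebraMap_eq_smul_one, sub_add_cancel, ← mul_one (ι d (eps j))] at h2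
    · intro Y hY
      exact (hL Y).2 (hTn Y hY 1 hT1)
  -- The elements of `T` that `so(n+1)` sends into `T` again satisfy the closure properties, since
  -- `XYu = YXu + [X,Y]u`; by minimality they exhaust `T`.
  let T' : Submodule ℂ (U d) := T ⊓ ⨅ X : so d, T.comap (LinearMap.mulLeft ℂ (ι d X))
  have hT' : ∀ v, v ∈ T' ↔ v ∈ T ∧ ∀ X, ι d X * v ∈ T := fun v => by
    simp [T', Submodule.mem_iInf]
  have hTT' : T ≤ T' := by
    refine sInf_le ⟨fun u hu => ?_, ?_, fun Y hY u hu => ?_⟩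
    · exact (hT' u).2 ⟨hTI u hu, fun X => hTI _ ((I lam).mul_mem_left _ hu)⟩
    · exact (hT' 1).2 ⟨hT1, hX1⟩
    · rw [hT'] at hu ⊢
      refine ⟨hTn Y hY u hu.1, fun X => ?_⟩
      have h : ι d X * (ι d Y * u) = ι d Y * (ι d X * u) + ι d ⁅X, Y⁆ * u := by
        rw [LieHom.map_lie, Ring.lie_def, sub_mul, ← mul_assoc, ← mul_assoc]; abel
      rw [h]
      exact T.add_mem (hTn Y hY _ (hu.2 X)) (hu.2 _)
  have hall : u ∈ T := mem_of_ι_mul_mem T hT1 (fun X t ht => ((hT' t).1 (hTT' ht)).2 X) u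
  exact (Submodule.mem_sInf).1 hall S ⟨hI, h1, hS⟩

/-! ### Degrees modulo `I(λ)` -/

/-- The grading element, shifted so as to annihilate the highest weight vector. -/
noncomputable def shiftedGrading : U d :=
  ι d (grading d : H d) - algebraMap ℂ (U d) (lam (grading d))

theorem shiftedGrading_mem : shiftedGrading lam ∈ I lam :=
  Ideal.subset_span (.inr ⟨grading d, rfl⟩)

/-- Representatives of the vectors of degree `-k` in the Verma module. -/
noncomputable def degreeSubmodule (k : ℕ) : Submodule ℂ (U d) :=
  ((I lam).restrictScalars ℂ).comap
    (LinearMap.mulLeft ℂ (shiftedGrading lam + algebraMap ℂ (U d) (k : ℂ)))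

theorem mem_degreeSubmodule {k : ℕ} {u : U d} : u ∈ degreeSubmodule lam k ↔
    (shiftedGrading lam + algebraMap ℂ (U d) (k : ℂ)) * u ∈ I lam := Iff.rfl

theorem negDegree_mul_mem {Y : so d} {s : ℕ}
    (hY : ⁅((grading d : H d) : so d), Y⁆ = (-(s : ℂ)) • Y) {k : ℕ} {u : U d}
    (hu : u ∈ degreeSubmodule lam k) : ι d Y * u ∈ degreeSubmodule lam (k + s) := by
  rw [mem_degreeSubmodule] at hu ⊢
  have h := congrArg (ι d) hY
  rw [LieHom.map_lie, Ring.lie_def, map_smul, neg_smul, Algebra.smul_def] at h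
  have hc : ∀ c : ℂ, algebraMap ℂ (U d) c * ι d Y = ι d Y * algebraMap ℂ (U d) c :=
    fun c => Algebra.commutes c _
  have h2 : (shiftedGrading lam + algebraMap ℂ (U d) ((k + s : ℕ) : ℂ)) * ι d Y =
      ι d Y * (shiftedGrading lam + algebraMap ℂ (U d) (k : ℂ)) := by
    rw [shiftedGrading, Nat.cast_add, map_add]
    simp only [add_mul, sub_mul, mul_add, mul_sub, hc] at h ⊢
    rw [sub_eq_iff_eq_add.1 h]
    abel
  rw [← mul_assoc, h2, mul_assoc]
  exact (I lam).mul_mem_left _ hu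

theorem exists_add_of_degree (u : U d) :
    ∃ c : ℂ, ∃ w ∈ Submodule.span ℂ (⋃ k ≥ 1, (degreeSubmodule lam k : Set (U d))),
      u = algebraMap ℂ (U d) c + w := by
  set F := Submodule.span ℂ (⋃ k ≥ 1, (degreeSubmodule lam k : Set (U d))) with hF
  have hmemF : ∀ k ≥ 1, ∀ w ∈ degreeSubmodule lam k, w ∈ F := fun k hk w hw =>
    Submodule.subset_span (Set.mem_iUnion₂.2 ⟨k, hk, hw⟩)
  have hone : (1 : U d) ∈ degreeSubmodule lam 0 := by
    rw [mem_degreeSubmodule]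
    simpa using shiftedGrading_mem lam
  have h : u ∈ Submodule.span ℂ {(1 : U d)} ⊔ F := by
    refine mem_of_negDegree_mul_mem lam _ ?_ ?_ ?_ u
    · intro u hu
      -- Elements of `I(λ)` represent zero and so lie in every degree; degree one is as good as any.
      refine Submodule.mem_sup_right (hmemF 1 le_rfl u ?_)
      exact (mem_degreeSubmodule lam).2 ((I lam).mul_mem_left _ hu)
    · exact Submodule.mem_sup_left (Submodule.mem_span_singleton_self _)
    · rintro Y ⟨s, hs, hY⟩ u hu
      refine Submodule.mem_sup_right ?_
      obtain ⟨v, hv, w, hw, rfl⟩ := Submodule.mem_sup.1 hu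
      obtain ⟨c, rfl⟩ := Submodule.mem_span_singleton.1 hv
      rw [mul_add, mul_smul_comm]
      refine F.add_mem (F.smul_mem c (hmemF _ (by omega) _ (negDegree_mul_mem lam hY hone))) ?_
      refine Submodule.span_induction (p := fun w _ => ι d Y * w ∈ F) ?_ ?_ ?_ ?_ hw
      · intro w hw
        obtain ⟨k, hk, hw⟩ := Set.mem_iUnion₂.1 hw
        exact hmemF (k + s) (by omega) _ (negDegree_mul_mem lam hY hw)
      · rw [mul_zero]; exact F.zero_mem
      · intro x y _ _ hx hy
        rw [mul_add]; exact F.add_mem hx hy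
      · intro c x _ hx
        rw [mul_smul_comm]; exact F.smul_mem c hx
  obtain ⟨v, hv, w, hw, rfl⟩ := Submodule.mem_sup.1 h
  obtain ⟨c, rfl⟩ := Submodule.mem_span_singleton.1 hv
  exact ⟨c, w, hw, by rw [Algebra.algebraMap_eq_smul_one]⟩

open Polynomial in
-- A component of degree `-k` is killed modulo `I(λ)` by `h + k`, with `h` the shifted grading
-- element. Multiplying finitely many such factors with `k ≥ 1` keeps the constant term nonzero.
theorem exists_polynomial_mul_mem {w : U d}
    (hw : w ∈ Submodule.span ℂ (⋃ k ≥ 1, (degreeSubmodule lam k : Set (U d)))) :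
    ∃ p : ℂ[X], p.coeff 0 ≠ 0 ∧ aeval (shiftedGrading lam) p * w ∈ I lam := by
  refine Submodule.span_induction (p := fun w _ => ∃ p : ℂ[X], p.coeff 0 ≠ 0 ∧
    aeval (shiftedGrading lam) p * w ∈ I lam) ?_ ?_ ?_ ?_ hw
  · intro w hw
    obtain ⟨k, hk, hw⟩ := Set.mem_iUnion₂.1 hw
    refine ⟨X + C (k : ℂ), ?_, ?_⟩
    · simp; omega
    · rw [map_add, aeval_X, aeval_C]
      exact hw
  · exact ⟨1, by simp, by rw [mul_zero]; exact (I lam).zero_mem⟩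
  · rintro x y _ _ ⟨p, hp, hpx⟩ ⟨q, hq, hqy⟩
    refine ⟨p * q, by rw [mul_coeff_zero]; exact mul_ne_zero hp hq, ?_⟩
    rw [mul_add]
    refine (I lam).add_mem ?_ ?_
    · rw [mul_comm p q, map_mul, mul_assoc]
      exact (I lam).mul_mem_left _ hpx
    · rw [map_mul, mul_assoc]
      exact (I lam).mul_mem_left _ hqy
  · rintro c x _ ⟨p, hp, hpx⟩
    refine ⟨p, hp, ?_⟩
    rw [mul_smul_comm, Algebra.smul_def]
    exact (I lam).mul_mem_left _ hpx

open Polynomial in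
-- Apply a polynomial `p(h)` that kills `w` modulo `I(λ)`. As `h` itself lies in `I(λ)`, `p(h)`
-- sends the scalar `c` to `p(0)c ≠ 0` modulo `I(λ)`, so the ideal contains a unit.
theorem eq_top_of_algebraMap_add_mem {K : Ideal (U d)} (hK : I lam ≤ K) {c : ℂ} (hc : c ≠ 0)
    {w : U d} (hw : w ∈ Submodule.span ℂ (⋃ k ≥ 1, (degreeSubmodule lam k : Set (U d))))
    (h : algebraMap ℂ (U d) c + w ∈ K) : K = ⊤ := by
  obtain ⟨p, hp, hpw⟩ := exists_polynomial_mul_mem lam hw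
  have h1 := K.mul_mem_left (aeval (shiftedGrading lam) p) h
  rw [mul_add] at h1
  have h2 := (K.add_mem_iff_left (hK hpw)).1 h1
  have h3 : aeval (shiftedGrading lam) p =
      aeval (shiftedGrading lam) p.divX * shiftedGrading lam + algebraMap ℂ (U d) (p.coeff 0) := by
    conv_lhs => rw [← divX_mul_X_add p]
    simp
  rw [h3, add_mul, mul_assoc, ← Algebra.commutes, ← mul_assoc] at h2
  have h4 : aeval (shiftedGrading lam) p.divX * algebraMap ℂ (U d) c * shiftedGrading lam ∈ K :=
    K.mul_mem_left _ (hK (shiftedGrading_mem lam))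
  have h5 := (K.add_mem_iff_right h4).1 h2
  rw [← map_mul] at h5
  rw [Ideal.eq_top_iff_one]
  have h6 := K.mul_mem_left (algebraMap ℂ (U d) (p.coeff 0 * c)⁻¹) h5
  rwa [← map_mul, inv_mul_cancel₀ (mul_ne_zero hp hc), map_one] at h6

end Triangular

/-! ### Simplicity of `Z(λ)` -/

section Simple

variable {d : ℕ} {t : Fin (rk d)} {x : ℂ} {lam : Module.Dual ℂ (H d)}

/-- The weights `(-1, …, -1, x, 0, …, 0)`. -/
def IsHookWeight (lam : Module.Dual ℂ (H d)) (t : Fin (rk d)) (x : ℂ) : Prop :=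
  (∀ j, j < t → lam (epsH j) = -1) ∧ lam (epsH t) = x ∧ ∀ j, t < j → lam (epsH j) = 0

theorem IsHookWeight.apply (h : IsHookWeight lam t x) (j : Fin (rk d)) :
    lam (epsH j) = if j < t then -1 else if j = t then x else 0 := by
  split_ifs with h1 h2
  · exact h.1 j h1
  · rw [h2]; exact h.2.1
  · exact h.2.2 j (lt_of_le_of_ne (not_lt.1 h1) (Ne.symm h2))

theorem hwRep_H_baseVec (h : IsHookWeight lam t x) (X : H d) :
    hwRep t x (ι d X) (baseVec (IsoIndex d)) = lam X • baseVec (IsoIndex d) := by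
  let f : H d →ₗ[ℂ] ((IsoIndex d → ℤ) → ℂ) :=
    LinearMap.applyₗ (baseVec (IsoIndex d)) ∘ₗ (hwRep t x).toLinearMap ∘ₗ
      (ι d : so d →ₗ[ℂ] U d) ∘ₗ (H d).subtype
  let g : H d →ₗ[ℂ] ((IsoIndex d → ℤ) → ℂ) := lam.smulRight (baseVec (IsoIndex d))
  have hfg : f = g := by
    refine linearMap_H_ext fun j => ?_
    ext m
    change hwRep t x (ι d (eps j)) (baseVec (IsoIndex d)) m =
      lam (epsH j) * baseVec (IsoIndex d) m
    rw [hwRep_eps, h.apply j, baseVec, Pi.single_apply]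
    split_ifs with h1 h2 h3 h4 <;> simp_all
  exact LinearMap.congr_fun hfg X

/-- The Cartan operators are diagonal, so the coefficient of the base monomial is an
eigenfunctional. This separates the base vector from the components of negative degree. -/
theorem hwRep_H_apply_zero (h : IsHookWeight lam t x) (X : H d) (ψ : (IsoIndex d → ℤ) → ℂ) :
    hwRep t x (ι d X) ψ 0 = lam X * ψ 0 := by
  let f : H d →ₗ[ℂ] ℂ :=
    (LinearMap.proj (0 : IsoIndex d → ℤ)) ∘ₗ LinearMap.applyₗ ψ ∘ₗ (hwRep t x).toLinearMap ∘ₗ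
      (ι d : so d →ₗ[ℂ] U d) ∘ₗ (H d).subtype
  let g : H d →ₗ[ℂ] ℂ := lam.smulRight (ψ 0)
  have hfg : f = g := by
    refine linearMap_H_ext fun j => ?_
    change hwRep t x (ι d (eps j)) ψ 0 = lam (epsH j) * ψ 0
    rw [hwRep_eps, h.apply j]
    simp
  exact LinearMap.congr_fun hfg X

/-- The annihilator of the highest weight vector. -/
noncomputable def hwAnnihilator (t : Fin (rk d)) (x : ℂ) : Ideal (U d) where
  carrier := {u | hwRep t x u (baseVec (IsoIndex d)) = 0}
  zero_mem' := by simp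
  add_mem' {u v} hu hv := by
    change hwRep t x (u + v) _ = 0
    rw [map_add, LinearMap.add_apply, hu, hv, add_zero]
  smul_mem' u v hv := by
    change hwRep t x (u * v) _ = 0
    rw [map_mul, Module.End.mul_apply, hv, map_zero]

theorem mem_hwAnnihilator {u : U d} :
    u ∈ hwAnnihilator t x ↔ hwRep t x u (baseVec (IsoIndex d)) = 0 := Iff.rfl

theorem I_le_hwAnnihilator (h : IsHookWeight lam t x) : I lam ≤ hwAnnihilator t x := by
  refine Ideal.span_le.2 ?_
  rintro _ (⟨X, hX, rfl⟩ | ⟨X, rfl⟩)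
  · exact hwRep_posRootVectors t x hX
  · change hwRep t x (ι d X - algebraMap ℂ (U d) (lam X)) _ = 0
    rw [map_sub, LinearMap.sub_apply, hwRep_H_baseVec h, AlgHom.commutes, Algebra.algebraMap_eq_smul_one,
      LinearMap.smul_apply, Module.End.one_apply, sub_self]

theorem one_not_mem_hwAnnihilator : (1 : U d) ∉ hwAnnihilator t x := by
  rw [mem_hwAnnihilator, map_one, Module.End.one_apply]
  intro h
  have := congrFun h 0
  simp [baseVec] at this

theorem hwAnnihilator_ne_top : hwAnnihilator (d := d) t x ≠ ⊤ := fun h =>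
  one_not_mem_hwAnnihilator ((Ideal.eq_top_iff_one _).1 h)

/-- The left ideal of all `u` such that no element of `U u` has a component along the highest
weight vector. -/
noncomputable def coefficientIdeal (t : Fin (rk d)) (x : ℂ) : Ideal (U d) where
  carrier := {u | ∀ w : U d, hwRep t x (w * u) (baseVec (IsoIndex d)) 0 = 0}
  zero_mem' := by simp
  add_mem' {u v} hu hv w := by
    rw [mul_add, map_add, LinearMap.add_apply, Pi.add_apply, hu, hv, add_zero]
  smul_mem' u v hv w := by
    rw [smul_eq_mul, ← mul_assoc]
    exact hv _

theorem hwRep_span_degree (h : IsHookWeight lam t x) {w : U d}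
    (hw : w ∈ Submodule.span ℂ (⋃ k ≥ 1, (degreeSubmodule lam k : Set (U d)))) :
    hwRep t x w (baseVec (IsoIndex d)) 0 = 0 := by
  refine Submodule.span_induction
    (p := fun w _ => hwRep t x w (baseVec (IsoIndex d)) 0 = 0) ?_ ?_ ?_ ?_ hw
  · intro w hw
    obtain ⟨k, hk, hw⟩ := Set.mem_iUnion₂.1 hw
    have h1 := congrFun ((mem_hwAnnihilator).1 (I_le_hwAnnihilator h hw)) 0
    change hwRep t x ((shiftedGrading lam + algebraMap ℂ (U d) (k : ℂ)) * w) _ 0 = 0 at h1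
    rw [map_mul, map_add, shiftedGrading, map_sub, AlgHom.commutes, AlgHom.commutes,
      Module.End.mul_apply, LinearMap.add_apply, LinearMap.sub_apply, Pi.add_apply, Pi.sub_apply,
      hwRep_H_apply_zero h, Algebra.algebraMap_eq_smul_one, Algebra.algebraMap_eq_smul_one] at h1
    simp only [LinearMap.smul_apply, Module.End.one_apply, Pi.smul_apply, smul_eq_mul, sub_self,
      zero_add] at h1
    refine (mul_eq_zero.1 h1).resolve_left ?_
    have : k ≠ 0 := by omega
    exact_mod_cast this
  · simp
  · intro u v _ _ hu hv
    rw [map_add, LinearMap.add_apply, Pi.add_apply, hu, hv, add_zero]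
  · intro c u _ hu
    rw [map_smul, LinearMap.smul_apply, Pi.smul_apply, hu, smul_zero]

/-- An element of `K` has no scalar part, since otherwise `K = U`, and components of negative degree
have coefficient zero at the base monomial. The bound does not depend on `K`, so it passes to the
sum `J(λ)`. -/
theorem le_coefficientIdeal (h : IsHookWeight lam t x) {K : Ideal (U d)} (hI : I lam ≤ K)
    (hK : K ≠ ⊤) : K ≤ coefficientIdeal t x := by
  intro u hu w
  have hwu : w * u ∈ K := K.mul_mem_left w hu
  obtain ⟨c, v, hv, hcv⟩ := exists_add_of_degree lam (w * u)
  by_cases hc : c = 0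
  · rw [hcv, hc, map_zero, zero_add]
    exact hwRep_span_degree h hv
  · rw [hcv] at hwu
    exact absurd (eq_top_of_algebraMap_add_mem lam hI hc hv hwu) hK

theorem J_ne_top (h : IsHookWeight lam t x) : J lam ≠ ⊤ := by
  intro hJ
  have hle : J lam ≤ coefficientIdeal t x := sSup_le fun K hK => le_coefficientIdeal h hK.1 hK.2
  have h1 : (1 : U d) ∈ coefficientIdeal t x := hle (hJ ▸ Submodule.mem_top)
  have h2 := h1 1
  rw [mul_one, map_one, Module.End.one_apply] at h2
  simp [baseVec] at h2

theorem isSimpleModule_Z (h : IsHookWeight lam t x) : IsSimpleModule (U d) (Z lam) := by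
  rw [isSimpleModule_iff_isCoatom]
  refine ⟨J_ne_top h, fun K hK => ?_⟩
  by_contra hne
  have hIJ : I lam ≤ J lam := (I_le_hwAnnihilator h).trans
    (le_J_of_ne_top (I_le_hwAnnihilator h) hwAnnihilator_ne_top)
  exact absurd (le_J_of_ne_top (hIJ.trans hK.le) hne) hK.not_ge

/-- For `q` in `Q(A)` and `u` in `U`, the product `q u` acts by zero in the monomial representation.
It thus lies in the annihilator of the base vector, which is contained in `J(λ)`. -/
theorem Q_smul_Z (h : IsHookWeight lam t x) : ∀ q ∈ Q d, ∀ m : Z lam, q • m = 0 := by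
  intro q hq m
  obtain ⟨u, rfl⟩ := Submodule.Quotient.mk_surjective _ m
  rw [← Submodule.Quotient.mk_smul, Submodule.Quotient.mk_eq_zero]
  refine le_J_of_ne_top (I_le_hwAnnihilator h) hwAnnihilator_ne_top ?_
  rw [mem_hwAnnihilator, smul_eq_mul, map_mul, hwRep, WeylPair.repU_eq_zero_of_mem_Q _ hq, zero_mul,
    LinearMap.zero_apply]

end Simple

/-! ### The weights of the classification -/

theorem exists_isHookWeight {d : ℕ} {lam : Module.Dual ℂ (H d)}
    (h : ∀ j k : Fin (rk d), j < k → lam (epsH k) * (lam (epsH j) + 1) = 0) :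
    ∃ t x, IsHookWeight lam t x := by
  have hpos : 0 < rk d := by
    have : 0 < (d + 3) / 2 := by omega
    exact this
  -- The index `t` is the last one with `λ_t ≠ 0`; the condition then forces `-1` before it. For `λ
  -- = 0` the first index serves, with `x = 0`.
  by_cases hall : ∀ j : Fin (rk d), lam (epsH j) = 0
  · refine ⟨⟨0, hpos⟩, lam (epsH ⟨0, hpos⟩), fun j hj => ?_, rfl, fun j _ => hall j⟩
    exact absurd hj (Nat.not_lt_zero _)
  · push Not at hall
    let S : Finset (Fin (rk d)) := Finset.univ.filter fun j => lam (epsH j) ≠ 0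
    have hS : S.Nonempty := by
      obtain ⟨j, hj⟩ := hall
      exact ⟨j, by simp [S, hj]⟩
    refine ⟨S.max' hS, lam (epsH (S.max' hS)), fun j hj => ?_, rfl, fun j hj => ?_⟩
    · have h1 : lam (epsH (S.max' hS)) ≠ 0 := (Finset.mem_filter.1 (S.max'_mem hS)).2
      have := (mul_eq_zero.1 (h j _ hj)).resolve_left h1
      linear_combination this
    · by_contra hne
      exact absurd (S.le_max' j (by simp [S, hne])) (not_le.2 hj)

theorem fundWeight_epsH {d : ℕ} (k : ℕ) (j : Fin (rk d)) :
    fundWeight d k (epsH j) = if k = rk d then 2⁻¹ else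
      if Even (d + 3) ∧ k + 1 = rk d then (if (j : ℕ) < k then 2⁻¹ else -2⁻¹)
      else if (j : ℕ) < k then 1 else 0 := by
  unfold fundWeight
  split_ifs <;>
    simp only [LinearMap.smul_apply, sum_coord_epsH, sum_coord_epsH_one, smul_eq_mul] <;>
    simp_all

theorem isHookWeight_fundForm {d : ℕ} (hd : 1 ≤ d) {t : ℕ} (x : ℂ) (ht1 : 1 ≤ t)
    (ht2 : t ≤ rk d) :
    IsHookWeight (fundForm d t x) ⟨t - 1, by omega⟩ x := by
  -- Rank at least two ensures that index zero is not one of the spin cases of `fundWeight`, so that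
  -- `π_0` is zero as required for `t = 1`.
  have hN : 2 ≤ rk d := by
    have : 2 ≤ (d + 3) / 2 := by omega
    exact this
  have key : ∀ j : Fin (rk d), fundForm d t x (epsH j) =
      if (j : ℕ) + 1 < t then -1 else if (j : ℕ) + 1 = t then x else 0 := by
    intro j
    have hj : (j : ℕ) < rk d := j.2
    unfold fundForm
    split_ifs <;>
    simp only [LinearMap.add_apply, LinearMap.smul_apply, fundWeight_epsH, smul_eq_mul] <;>
    grind
  refine ⟨fun j hj => ?_, ?_, fun j hj => ?_⟩
  · have : (j : ℕ) < t - 1 := hj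
    rw [key, if_pos (by omega)]
  · rw [key]
    dsimp only
    rw [if_neg (by omega), if_pos (by omega)]
  · have : t - 1 < (j : ℕ) := hj
    rw [key, if_neg (by omega), if_neg (by omega)]

theorem eq_fundForm_of_isHookWeight {d : ℕ} (hd : 1 ≤ d) {lam : Module.Dual ℂ (H d)}
    {t : Fin (rk d)} {x : ℂ} (h : IsHookWeight lam t x) : lam = fundForm d (t + 1) x := by
  refine linearMap_H_ext fun j => ?_
  have h2 := isHookWeight_fundForm hd x (t := t + 1) (by omega) t.2
  rw [h.apply, h2.apply]
  simp only [Nat.add_sub_cancel, Fin.eta]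

end NLie

/-- Here `n = d + 2` and `N = ⌊(n+1)/2⌋ = NLie.rk d`; `λ_j` is `lam (NLie.epsH j)`. -/
theorem theorem4p1 (d : ℕ) (hn : 3 ≤ d + 2) (lam : Module.Dual ℂ (NLie.H d)) :
    List.TFAE [
      NLie.IsIrreducibleAModule lam,
      IsSimpleModule (NLie.U d) (NLie.Z lam) ∧
        ∀ q ∈ NLie.Q d, ∀ m : NLie.Z lam, q • m = 0,
      ∃ (t : Fin (NLie.rk d)) (x : ℂ),
        (∀ j, j < t → lam (NLie.epsH j) = -1) ∧ lam (NLie.epsH t) = x ∧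
          ∀ j, t < j → lam (NLie.epsH j) = 0,
      ∀ j k : Fin (NLie.rk d), j < k → lam (NLie.epsH k) * (lam (NLie.epsH j) + 1) = 0,
      ∃ (t : ℕ) (x : ℂ), 1 ≤ t ∧ t ≤ NLie.rk d ∧ lam = NLie.fundForm d t x] := by
  have hd : 1 ≤ d := by omega
  tfae_have 1 ↔ 2 := NLie.isIrreducibleAModule_iff lam
  tfae_have 2 → 4 := fun ⟨_, hQ⟩ => NLie.weight_condition_of_Q_smul hQ
  tfae_have 4 → 3 := NLie.exists_isHookWeight
  tfae_have 3 → 2 := fun ⟨t, x, h⟩ =>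
    have h : NLie.IsHookWeight lam t x := h
    ⟨NLie.isSimpleModule_Z h, NLie.Q_smul_Z h⟩
  tfae_have 3 → 5 := fun ⟨t, x, h⟩ =>
    have h : NLie.IsHookWeight lam t x := h
    ⟨t + 1, x, by omega, t.2, NLie.eq_fundForm_of_isHookWeight hd h⟩
  tfae_have 5 → 3 := by
    rintro ⟨t, x, ht1, ht2, rfl⟩
    exact ⟨_, x, NLie.isHookWeight_fundForm hd x ht1 ht2⟩
  tfae_finish
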